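/- **Theorem (Inverse Clifford $Cl_n$ wavelet transform).** Let $n\equiv 2$ or $3 \pmod 4$. Let $Cl_n=Cl_{n,0}$ be the real Clifford algebra of Euclidean space $\mathbb{R}^n$, with basis blades $e_A=e_{i_1}\cdots e_{i_k}$ ($A=\{i_1<\dots<i_k\}\subseteq\{1,\dots,n\}$), modulus $|\sum_A M_Ae_A|^2=\sum_A M_A^2$, reversion $M\mapsto\widetilde M$ and unit pseudoscalar $i_n=e_1e_2\cdots e_n$ (so $i_n^2=-1$). Write $(f,g)=\int_{\mathbb{R}^n} f(x)\,\widetilde{g(x)}\,d^nx\in Cl_n$ for $f,g\in L^2(\mathbb{R}^n;Cl_n)$, and let $\widehat f(\omega)=\int_{\mathbb{R}^n} f(x)\,e^{-i_n\,\omega\cdot x}\,d^nx$ be the Clifford Fourier transform, extended to $L^2(\mathbb{R}^n;Cl_n)$ as the $L^2$-limit of the integrals over the balls $|x|<R$ as $R\to\infty$. Let $d\theta$ be a Haar measure on $SO(n)$ (with any normalization), $d\mu(a,\theta)=a^{-(n+1)}\,da\,d\theta$ on $\mathbb{R}^+\times SO(n)$, and $d\lambda=d\mu(a,\theta)\,d^nb$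 on $SIM(n)=(\mathbb{R}^+\times SO(n))\rtimes\mathbb{R}^n$. For $\psi\in L^2(\mathbb{R}^n;Cl_n)$ put $$\psi_{a,\theta,b}(x)=a^{-n/2}\,\psi\big(r_\theta^{-1}(\tfrac{x-b}{a})\big),\qquad T_\psi f(a,\theta,b)=(f,\psi_{a,\theta,b})=\int_{\mathbb{R}^n} f(x)\,\widetilde{\psi_{a,\theta,b}(x)}\,d^nx .$$ Assume that $\psi$ is admissible, i.e. for almost every $\omega\in\mathbb{R}^n$ the integral $$C_\psi=\int_{\mathbb{R}^+}\int_{SO(n)}a^n\,\{\widehat\psi(a\,r_\theta^{-1}\omega)\}^{\sim}\,\widehat\psi(a\,r_\theta^{-1}\omega)\,d\mu(a,\theta)$$ converges absolutely and equals one and the same invertible element $C_\psi$ of $Cl_n$; if $n\equiv2\pmod 4$, assume moreover that $\psi$ takes its values (almost everywhere) in the even part $Cl_n^+$, or that it takes them in the odd part $Cl_n^-$. Then every $f\in L^2(\mathbb{R}^n;Cl_n)$ satisfies $$f=\int_{SIM(n)}T_\psi f(a,\theta,b)\,\psi_{a,\theta,b}\,C_\psi^{-1}\,d\mu\,d^nb=\int_{SIM(n)}(f,\psi_{a,\theta,b})\,\psi_{a,\theta,b}\,C_\psi^{-1}\,d\mu\,d^nb,$$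 the integrals converging in the weak sense: for every $g\in L^2(\mathbb{R}^n;Cl_n)$ the function $(a,\theta,b)\mapsto\big(T_\psi f(a,\theta,b)\,\psi_{a,\theta,b}\,C_\psi^{-1},\,g\big)$ is $\lambda$-integrable and its integral is $(f,g)$. -/

import Mathlib

open MeasureTheory Filter Topology

noncomputable section

namespace CliffordWavelet

/-- Euclidean space `ℝⁿ`. -/
abbrev E (n : ℕ) : Type := EuclideanSpace ℝ (Fin n)

/-- The quadratic form `x ↦ x · x` on `ℝⁿ`. -/
def quadForm (n : ℕ) : QuadraticForm ℝ (E n) := LinearMap.BilinMap.toQuadraticMap (innerₗ (E n))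

/-- The real Clifford algebra `Cl_n = Cl_{n,0}`. -/
abbrev Cl (n : ℕ) : Type := CliffordAlgebra (quadForm n)

/-- The standard orthonormal basis vector `e_i` of `ℝⁿ`, as an element of `Cl_n`. -/
def stdVec {n : ℕ} (i : Fin n) : Cl n :=
  CliffordAlgebra.ι (quadForm n) (EuclideanSpace.basisFun (Fin n) ℝ i)

/-- The basis blade `e_A = e_{i₁} ⋯ e_{i_k}`, for `A = {i₁ < ⋯ < i_k}`. -/
def blade {n : ℕ} (A : Finset (Fin n)) : Cl n := ((A.sort (· ≤ ·)).map stdVec).prod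

/-- The blades `e_A` form a basis of `Cl_n`: they correspond to the standard basis of the exterior
algebra (see `bladeBasis_apply`). -/
def bladeBasis (n : ℕ) : Module.Basis (Finset (Fin n)) ℝ (Cl n) :=
  (EuclideanSpace.basisFun (Fin n) ℝ).toBasis.ExteriorAlgebra.map
    (CliffordAlgebra.equivExterior (quadForm n)).symm

theorem contractLeft_prod_eq_zero {n : ℕ} (i : Fin n) (l : List (Fin n)) (hl : i ∉ l)
    (d : Module.Dual ℝ (E n)) (hd : ∀ j, j ≠ i → d (EuclideanSpace.basisFun (Fin n) ℝ j) = 0) :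
    CliffordAlgebra.contractLeft d ((l.map fun j =>
      CliffordAlgebra.ι (0 : QuadraticForm ℝ (E n)) (EuclideanSpace.basisFun (Fin n) ℝ j)).prod)
      = 0 := by
  induction l with
  | nil => simp
  | cons j l ih =>
    have hj : j ≠ i := fun h => hl (by simp [h])
    have hl' : i ∉ l := fun h => hl (by simp [h])
    rw [List.map_cons, List.prod_cons, CliffordAlgebra.contractLeft_ι_mul, ih hl', hd j hj]
    simp

theorem equivExterior_prod {n : ℕ} (l : List (Fin n)) (hl : l.Nodup) :
    CliffordAlgebra.equivExterior (quadForm n) ((l.map stdVec).prod) =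
      (l.map fun j => ExteriorAlgebra.ι ℝ (EuclideanSpace.basisFun (Fin n) ℝ j)).prod := by
  induction l with
  | nil =>
    exact CliffordAlgebra.changeForm_one (CliffordAlgebra.changeForm.associated_neg_proof)
  | cons j l ih =>
    have h := List.nodup_cons.1 hl
    have ih := ih h.2
    rw [List.map_cons, List.prod_cons, List.map_cons, List.prod_cons]
    refine (CliffordAlgebra.changeForm_ι_mul
      (CliffordAlgebra.changeForm.associated_neg_proof (Q := quadForm n)) _ _).trans ?_
    have ih' : CliffordAlgebra.changeForm
        (CliffordAlgebra.changeForm.associated_neg_proof (Q := quadForm n)) ((l.map stdVec).prod) =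
        (l.map fun j =>
          CliffordAlgebra.ι (0 : QuadraticForm ℝ (E n)) (EuclideanSpace.basisFun (Fin n) ℝ j)).prod :=
      ih
    rw [ih', contractLeft_prod_eq_zero j l h.1, sub_zero]
    intro k hk
    simp [quadForm, QuadraticMap.associated_apply, inner_add_right,
      EuclideanSpace.inner_single_left, hk, hk.symm]

theorem bladeBasis_apply {n : ℕ} (A : Finset (Fin n)) : bladeBasis n A = blade A := by
  rw [bladeBasis, Module.Basis.map_apply, LinearEquiv.symm_apply_eq, blade,
    equivExterior_prod _ (Finset.sort_nodup _ _),
    ExteriorAlgebra.basis_apply_ofCard _ (rfl : A.card = A.card), ExteriorAlgebra.ιMulti_family,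
    ExteriorAlgebra.ιMulti_apply, ← Finset.listMap_orderEmbOfFin_finRange A rfl, List.ofFn_eq_map,
    List.map_map]
  rfl

/-- The coordinates `(M_A)_A` of a multivector `M = ∑_A M_A e_A`. -/
def coords (n : ℕ) : Cl n ≃ₗ[ℝ] EuclideanSpace ℝ (Finset (Fin n)) :=
  (bladeBasis n).equivFun.trans (WithLp.linearEquiv 2 ℝ (Finset (Fin n) → ℝ)).symm

/-- `Cl_n` is normed by the modulus `|M| = (∑_A M_A²)^{1/2}`. -/
instance instNormedAddCommGroupCl (n : ℕ) : NormedAddCommGroup (Cl n) :=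
  NormedAddCommGroup.induced (Cl n) (EuclideanSpace ℝ (Finset (Fin n))) (coords n)
    (coords n).injective

instance instNormedSpaceCl (n : ℕ) : NormedSpace ℝ (Cl n) :=
  NormedSpace.induced ℝ (Cl n) (EuclideanSpace ℝ (Finset (Fin n))) (coords n)

instance instFiniteDimensionalCl (n : ℕ) : FiniteDimensional ℝ (Cl n) :=
  Module.Basis.finiteDimensional_of_finite (bladeBasis n)

instance instIsTopologicalRingCl (n : ℕ) : IsTopologicalRing (Cl n) where
  continuous_mul := by
    have h : Continuous fun p : Cl n × Cl n =>
        ((LinearMap.toContinuousLinearMap : (Cl n →ₗ[ℝ] Cl n) ≃ₗ[ℝ] (Cl n →L[ℝ] Cl n)).toLinearMap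
          ∘ₗ LinearMap.mul ℝ (Cl n)) p.1 p.2 :=
      ((LinearMap.continuous_of_finiteDimensional _).comp continuous_fst).clm_apply continuous_snd
    exact h

/-- The unit pseudoscalar `i_n = e_1 e_2 ⋯ e_n`. -/
def pseudoscalar (n : ℕ) : Cl n := blade Finset.univ

/-- The reverse `M ↦ M̃`. -/
def rev {n : ℕ} (M : Cl n) : Cl n := CliffordAlgebra.reverse M

/-- The `Cl_n`-valued inner product `(f, g) = ∫ f(x) g(x)~ dⁿx`. -/
def cliffInner {n : ℕ} (f g : E n → Cl n) : Cl n := ∫ x, f x * rev (g x)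

/-- `F` is the Clifford Fourier transform of `f ∈ L²(ℝⁿ; Cl_n)`: it is the limit in `L²`, for
`R → ∞`, of the integrals `∫_{|x| < R} f(x) e^{-i_n ω·x} dⁿx`. (For `f ∈ L¹ ∩ L²` this is the
integral over `ℝⁿ`, for almost every `ω`.) -/
structure IsCFT {n : ℕ} (f F : E n → Cl n) : Prop where
  memLp : MemLp F 2 volume
  tendsto : Tendsto (fun R : ℝ => eLpNorm (fun ω => F ω -
      ∫ x in Metric.ball (0 : E n) R, f x * NormedSpace.exp (-(inner ℝ ω x) • pseudoscalar n))
      2 volume) atTop (𝓝 0)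

/-- The rotation group `SO(n)`. -/
abbrev SO (n : ℕ) : Type := Matrix.specialOrthogonalGroup (Fin n) ℝ

instance instMeasurableSpaceSO (n : ℕ) : MeasurableSpace (SO n) := borel _

instance instBorelSpaceSO (n : ℕ) : BorelSpace (SO n) := ⟨rfl⟩

/-- The action of a rotation on a vector. -/
def rot {n : ℕ} (r : SO n) (x : E n) : E n := Matrix.toEuclideanLin (r : Matrix _ _ ℝ) x

/-- The measure `dμ(a, θ) = da dθ / a^{n+1}` on `ℝ⁺ × SO(n)`, where `dθ` is `ν`. It is written as a
measure on `ℝ × SO(n)` that vanishes outside `a > 0`. -/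
def dilRotMeasure (n : ℕ) (ν : Measure (SO n)) : Measure (ℝ × SO n) :=
  ((volume.restrict (Set.Ioi (0 : ℝ))).withDensity
    fun a => ENNReal.ofReal (1 / a ^ (n + 1))).prod ν

/-- The measure `dλ = dμ(a, θ) dⁿb` on `SIM(n)`, whose elements are written `((a, r), b)`. -/
def simMeasure (n : ℕ) (ν : Measure (SO n)) : Measure ((ℝ × SO n) × E n) :=
  (dilRotMeasure n ν).prod volume

/-- The daughter wavelet `ψ_{a,θ,b}(x) = a^{-n/2} ψ(r_θ⁻¹((x - b) / a))`. -/
def daughter {n : ℕ} (ψ : E n → Cl n) (p : (ℝ × SO n) × E n) (x : E n) : Cl n :=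
  (1 / p.1.1 ^ ((n : ℝ) / 2)) • ψ (rot p.1.2⁻¹ ((1 / p.1.1) • (x - p.2)))

/-- The Clifford wavelet transform `T_ψ f(a,θ,b) = ∫ f(x) ψ_{a,θ,b}(x)~ dⁿx`. -/
def waveletTransform {n : ℕ} (ψ f : E n → Cl n) (p : (ℝ × SO n) × E n) : Cl n :=
  ∫ x, f x * rev (daughter ψ p x)

/-- The integrand `aⁿ {F(a r_θ⁻¹ ω)}~ F(a r_θ⁻¹ ω)` of the admissibility constant. -/
def admissibilityIntegrand {n : ℕ} (F : E n → Cl n) (ω : E n) (q : ℝ × SO n) : Cl n :=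
  q.1 ^ n • (rev (F (q.1 • rot q.2⁻¹ ω)) * F (q.1 • rot q.2⁻¹ ω))

/-- `ψ ∈ L²(ℝⁿ; Cl_n)` is an admissible mother wavelet with admissibility constant `C_ψ = C`: with
`ψ̂` its Clifford Fourier transform, the integral
`∫_{ℝ⁺} ∫_{SO(n)} aⁿ {ψ̂(a r_θ⁻¹ ω)}~ ψ̂(a r_θ⁻¹ ω) dμ(a, θ)`
converges and equals the invertible constant `C` for almost every `ω`. -/
structure IsAdmissible {n : ℕ} (ν : Measure (SO n)) (ψ : E n → Cl n) (C : Cl n) : Prop where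
  memLp : MemLp ψ 2 volume
  isUnit : IsUnit C
  constant : ∃ F : E n → Cl n, IsCFT ψ F ∧
    ∀ᵐ ω : E n, Integrable (admissibilityIntegrand F ω) (dilRotMeasure n ν) ∧
      ∫ q, admissibilityIntegrand F ω q ∂(dilRotMeasure n ν) = C

/-- The grade restriction on mother wavelets: for `n ≡ 2 (mod 4)`, `ψ` takes its values either in the
even part `Cl_n⁺` or in the odd part `Cl_n⁻`. There is none for `n ≡ 3 (mod 4)`. -/
def GradeRestricted {n : ℕ} (ψ : E n → Cl n) : Prop :=
  n % 4 = 2 → (∀ᵐ x : E n, ψ x ∈ CliffordAlgebra.evenOdd (quadForm n) 0) ∨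
    (∀ᵐ x : E n, ψ x ∈ CliffordAlgebra.evenOdd (quadForm n) 1)

/-- `f = ∫ Φ_p dm(p)` in the weak sense in `L²(ℝⁿ; Cl_n)`: `(f, g) = ∫ (Φ_p, g) dm(p)`, with an
absolutely convergent integral, for every `g ∈ L²(ℝⁿ; Cl_n)`. -/
def IsWeakIntegral {n : ℕ} {X : Type*} [MeasurableSpace X] (m : Measure X) (Φ : X → E n → Cl n)
    (f : E n → Cl n) : Prop :=
  (∀ᵐ p ∂m, MemLp (Φ p) 2 volume) ∧
    ∀ g : E n → Cl n, MemLp g 2 volume →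
      Integrable (fun p => cliffInner (Φ p) g) m ∧ ∫ p, cliffInner (Φ p) g ∂m = cliffInner f g

end CliffordWavelet

end

open CliffordWavelet

/-!
Right multiplication by `i_n` is a complex structure on `Cl_n`, and for it the Clifford Fourier
transform is `(2π)^{n/2}` times an isometry. For fixed `(a, θ)` the function `b ↦ T_ψ f(a, θ, b)`
is, up to the reflection `b ↦ -b` and the factor `(2π)⁻ⁿ`, the transform of
`f̂(ω) (a^{n/2} ψ̂(a r_θ⁻¹ ω))~`. Parseval's identity in `b` and Fubini's theorem therefore give
`∫ T_ψ f T_ψ h~ dλ = (2π)⁻ⁿ ∫ f̂ C_ψ ĥ~ dω`. The grade restriction makes `ψ̂` commute or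
anticommute with `i_n`: this is what allows the exponentials to be moved past `ψ̂`, and it makes
`C_ψ` commute with `i_n`, so that the transform of `g (C_ψ⁻¹)~` is `ĝ (C_ψ⁻¹)~`. The inversion
formula is the case `h = g (C_ψ⁻¹)~`.
-/

noncomputable section

namespace CliffordWavelet

/-! ### Products of basis vectors -/

section Blades

variable {n : ℕ}

/-- The product `e_{i₁} ⋯ e_{i_k}` of the basis vectors listed by `l`, in the order of `l`; thus
`e_A` is `vecProd` of the increasing enumeration of `A`. -/
def vecProd (l : List (Fin n)) : Cl n := (l.map stdVec).prod

@[simp] theorem vecProd_nil : vecProd ([] : List (Fin n)) = 1 := rfl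

@[simp] theorem vecProd_cons (i : Fin n) (l : List (Fin n)) :
    vecProd (i :: l) = stdVec i * vecProd l := rfl

theorem blade_eq_vecProd (A : Finset (Fin n)) : blade A = vecProd (A.sort (· ≤ ·)) := rfl

@[simp] theorem blade_empty : (blade ∅ : Cl n) = 1 := by simp [blade_eq_vecProd]

@[simp] theorem stdVec_mul_self (i : Fin n) : stdVec i * stdVec i = (1 : Cl n) := by
  have norm_sq : quadForm n (EuclideanSpace.basisFun (Fin n) ℝ i) = 1 := by simp [quadForm]
  rw [stdVec, CliffordAlgebra.ι_sq_scalar, norm_sq, map_one]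

theorem stdVec_mul_stdVec_of_ne {i j : Fin n} (h : i ≠ j) :
    (stdVec i * stdVec j : Cl n) = -(stdVec j * stdVec i) := by
  have orthogonal : QuadraticMap.polar (quadForm n) (EuclideanSpace.basisFun (Fin n) ℝ i)
      (EuclideanSpace.basisFun (Fin n) ℝ j) = 0 := by
    simp [quadForm, QuadraticMap.polar, inner_add_right, EuclideanSpace.inner_single_left, h,
      h.symm]
  rw [eq_neg_iff_add_eq_zero, stdVec, stdVec, CliffordAlgebra.ι_mul_ι_add_swap, orthogonal,
    map_zero]

theorem vecProd_perm {l l' : List (Fin n)} (h : l.Perm l') (hl : l.Nodup) :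
    ∃ s : ℤˣ, vecProd l = s • vecProd l' := by
  induction h with
  | nil => exact ⟨1, by simp⟩
  | cons i _ ih =>
    obtain ⟨s, hs⟩ := ih hl.of_cons
    exact ⟨s, by rw [vecProd_cons, vecProd_cons, hs, mul_smul_comm]⟩
  | swap i j l =>
    have hne : j ≠ i := by rintro rfl; simp at hl
    exact ⟨-1, by simp [← mul_assoc, stdVec_mul_stdVec_of_ne hne]⟩
  | trans h₁ _ ih₁ ih₂ =>
    obtain ⟨s, hs⟩ := ih₁ hl
    obtain ⟨t, ht⟩ := ih₂ (h₁.nodup_iff.1 hl)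
    exact ⟨s * t, by rw [hs, ht, mul_smul]⟩

theorem vecProd_mul_stdVec_of_notMem {l : List (Fin n)} {i : Fin n} (hi : i ∉ l) :
    vecProd l * stdVec i = (-1 : ℤˣ) ^ l.length • (stdVec i * vecProd l) := by
  induction l with
  | nil => simp
  | cons j l ih =>
    obtain ⟨hij, hil⟩ := not_or.1 (List.mem_cons.not.1 hi)
    rw [vecProd_cons, mul_assoc, ih hil, mul_smul_comm, ← mul_assoc,
      stdVec_mul_stdVec_of_ne (Ne.symm hij), List.length_cons, pow_succ, mul_smul]
    simp [mul_assoc]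

theorem blade_mul_stdVec_of_notMem {A : Finset (Fin n)} {i : Fin n} (hi : i ∉ A) :
    blade A * stdVec i = (-1 : ℤˣ) ^ A.card • (stdVec i * blade A) := by
  simpa [blade_eq_vecProd] using
    vecProd_mul_stdVec_of_notMem (l := A.sort (· ≤ ·)) (by simpa using hi)

theorem stdVec_mul_blade_of_notMem {A : Finset (Fin n)} {i : Fin n} (hi : i ∉ A) :
    ∃ s : ℤˣ, stdVec i * blade A = s • blade (insert i A) :=
  vecProd_perm (l := i :: A.sort (· ≤ ·))
    ((List.perm_ext_iff_of_nodup (by simp [hi]) (Finset.sort_nodup _ _)).2 (by simp)) (by simp [hi])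

open scoped symmDiff

theorem stdVec_mul_blade (i : Fin n) (A : Finset (Fin n)) :
    ∃ s : ℤˣ, stdVec i * blade A = s • blade ({i} ∆ A) := by
  by_cases hi : i ∈ A
  · have hA : {i} ∆ A = A.erase i := by
      rw [symmDiff_of_le (Finset.singleton_subset_iff.2 hi), Finset.erase_eq]
    obtain ⟨s, hs⟩ := stdVec_mul_blade_of_notMem (Finset.notMem_erase i A)
    rw [Finset.insert_erase hi, ← inv_smul_eq_iff] at hs
    exact ⟨s⁻¹, by rw [hA, ← hs, mul_smul_comm, ← mul_assoc, stdVec_mul_self, one_mul]⟩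
  · have hA : {i} ∆ A = insert i A :=
      (Finset.disjoint_singleton_left.2 hi).symmDiff_eq_sup
    rw [hA]
    exact stdVec_mul_blade_of_notMem hi

theorem blade_mul_blade (A B : Finset (Fin n)) :
    ∃ s : ℤˣ, blade A * blade B = s • blade (A ∆ B) := by
  induction A using Finset.induction with
  | empty => exact ⟨1, by rw [blade_empty, one_mul, one_smul, ← Finset.bot_eq_empty, bot_symmDiff]⟩
  | insert i A hi ih =>
    have hAB : insert i A ∆ B = {i} ∆ (A ∆ B) := by
      rw [← symmDiff_assoc, (Finset.disjoint_singleton_left.2 hi).symmDiff_eq_sup]; rfl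
    obtain ⟨s, hs⟩ := stdVec_mul_blade_of_notMem hi
    obtain ⟨t, ht⟩ := ih
    obtain ⟨u, hu⟩ := stdVec_mul_blade i (A ∆ B)
    rw [← inv_smul_eq_iff] at hs
    exact ⟨s⁻¹ * t * u, by
      rw [← hs, smul_mul_assoc, mul_assoc, ht, mul_smul_comm, hu, hAB, mul_smul, mul_smul]⟩

end Blades

/-! ### Reversion -/

section Reversion

variable {n : ℕ}

/-- Reversion as a linear map, which is what integrals and Fourier transforms commute with. -/
def revL (n : ℕ) : Cl n →L[ℝ] Cl n :=
  LinearMap.toContinuousLinearMap (CliffordAlgebra.reverse (Q := quadForm n))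

theorem revL_apply (M : Cl n) : revL n M = rev M := rfl

@[simp] theorem rev_mul (M N : Cl n) : rev (M * N) = rev N * rev M :=
  CliffordAlgebra.reverse.map_mul M N

@[simp] theorem rev_rev (M : Cl n) : rev (rev M) = M := CliffordAlgebra.reverse_reverse M

@[simp] theorem rev_one : rev (1 : Cl n) = 1 := CliffordAlgebra.reverse.map_one

@[simp] theorem rev_stdVec (i : Fin n) : rev (stdVec i : Cl n) = stdVec i :=
  CliffordAlgebra.reverse_ι _

@[simp] theorem rev_add (M N : Cl n) : rev (M + N) = rev M + rev N := map_add (revL n) M N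

@[simp] theorem rev_neg (M : Cl n) : rev (-M) = -rev M := map_neg (revL n) M

@[simp] theorem rev_smul (c : ℝ) (M : Cl n) : rev (c • M) = c • rev M := map_smul (revL n) c M

theorem vecProd_mul_rev (l : List (Fin n)) : vecProd l * rev (vecProd l) = (1 : Cl n) := by
  induction l with
  | nil => simp
  | cons i l ih =>
    rw [vecProd_cons, rev_mul, rev_stdVec, mul_assoc, ← mul_assoc (vecProd l), ih, one_mul,
      stdVec_mul_self]

theorem blade_mul_rev (A : Finset (Fin n)) : blade A * rev (blade A) = (1 : Cl n) :=
  vecProd_mul_rev _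

theorem rev_vecProd {l : List (Fin n)} (hl : l.Nodup) :
    rev (vecProd l) = (-1 : ℤˣ) ^ l.length.choose 2 • vecProd l := by
  induction l with
  | nil => simp
  | cons i l ih =>
    rw [vecProd_cons, rev_mul, rev_stdVec, ih hl.of_cons, smul_mul_assoc,
      vecProd_mul_stdVec_of_notMem hl.notMem, List.length_cons, Nat.choose_succ_succ' _ 1,
      Nat.choose_one_right, smul_smul, ← pow_add, add_comm l.length]

theorem rev_blade (A : Finset (Fin n)) :
    rev (blade A) = (-1 : ℤˣ) ^ A.card.choose 2 • (blade A : Cl n) := by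
  simpa [blade_eq_vecProd] using rev_vecProd (Finset.sort_nodup A (· ≤ ·))

end Reversion

/-! ### The modulus -/

section Modulus

variable {n : ℕ}

/-- The coordinate `M_A` of a multivector `M = ∑_A M_A e_A`. -/
def coord (A : Finset (Fin n)) : Cl n →L[ℝ] ℝ :=
  LinearMap.toContinuousLinearMap ((bladeBasis n).coord A)

theorem coord_blade (A B : Finset (Fin n)) :
    coord A (blade B) = if A = B then 1 else 0 := by
  rw [← bladeBasis_apply]
  simp [coord, Finsupp.single_apply, eq_comm]

theorem sum_coord_smul_blade (M : Cl n) : ∑ A, coord A M • blade A = M := by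
  simp_rw [← bladeBasis_apply]
  exact (bladeBasis n).sum_repr M

theorem ext_coord {M N : Cl n} (h : ∀ A, coord A M = coord A N) : M = N :=
  (bladeBasis n).ext_elem h

/-- The inner product whose norm is the modulus; the blades are orthonormal for it. -/
instance instInnerProductSpaceCl (n : ℕ) : InnerProductSpace ℝ (Cl n) where
  toNormedSpace := instNormedSpaceCl n
  inner M N := inner ℝ (coords n M) (coords n N)
  norm_sq_eq_re_inner M := norm_sq_eq_re_inner (𝕜 := ℝ) (coords n M)
  conj_inner_symm M N := inner_conj_symm (𝕜 := ℝ) (coords n M) (coords n N)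
  add_left M N P := by rw [map_add, inner_add_left]
  smul_left M N c := by rw [map_smul, inner_smul_left]

theorem inner_eq_sum_coord (M N : Cl n) : inner ℝ M N = ∑ A, coord A M * coord A N :=
  Finset.sum_congr rfl fun A _ => mul_comm (coord A N) (coord A M)

theorem norm_sq_eq_sum_coord (M : Cl n) : ‖M‖ ^ 2 = ∑ A, coord A M ^ 2 := by
  rw [← real_inner_self_eq_norm_sq, inner_eq_sum_coord]
  simp only [sq]

theorem coord_empty_blade_mul_rev_blade (A B : Finset (Fin n)) :
    coord ∅ (blade A * rev (blade B)) = if A = B then 1 else 0 := by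
  split_ifs with h
  · rw [h, blade_mul_rev, ← blade_empty, coord_blade, if_pos rfl]
  · obtain ⟨s, hs⟩ := blade_mul_blade A B
    have hAB : ∅ ≠ symmDiff A B := fun h' => h (symmDiff_eq_bot.1 h'.symm)
    rw [rev_blade, mul_smul_comm, hs, Units.smul_def, Units.smul_def, map_zsmul, map_zsmul,
      coord_blade, if_neg hAB, smul_zero, smul_zero]

theorem coord_empty_mul_rev (M N : Cl n) : coord ∅ (M * rev N) = inner ℝ M N := by
  conv_lhs => rw [← sum_coord_smul_blade M, ← sum_coord_smul_blade N, ← revL_apply]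
  simp only [map_sum, map_smul, Finset.sum_mul, Finset.mul_sum, smul_mul_smul_comm, revL_apply,
    coord_empty_blade_mul_rev_blade, inner_eq_sum_coord]
  simp

theorem coord_mul_rev (A : Finset (Fin n)) (M N : Cl n) :
    coord A (M * rev N) = inner ℝ M (blade A * N) := by
  have coord_eq_inner (P : Cl n) : coord A P = inner ℝ P (blade A) := by
    simp [inner_eq_sum_coord, coord_blade]
  rw [coord_eq_inner, ← coord_empty_mul_rev, ← coord_empty_mul_rev, rev_mul, mul_assoc]

theorem coord_rev (A : Finset (Fin n)) (M : Cl n) :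
    coord A (rev M) = (-1 : ℤˣ) ^ A.card.choose 2 • coord A M := by
  conv_lhs => rw [← sum_coord_smul_blade M, ← revL_apply]
  simp only [map_sum, map_smul, revL_apply, rev_blade, Units.smul_def, map_zsmul, coord_blade]
  simp [mul_comm]

@[simp] theorem norm_rev (M : Cl n) : ‖rev M‖ = ‖M‖ := by
  refine (sq_eq_sq₀ (norm_nonneg _) (norm_nonneg _)).1 ?_
  rw [norm_sq_eq_sum_coord, norm_sq_eq_sum_coord]
  refine Finset.sum_congr rfl fun A _ => ?_
  rw [coord_rev]
  rcases Int.units_eq_one_or ((-1) ^ A.card.choose 2) with h | h <;> simp [h]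

/-- Multiplication as a bilinear map, whose norm is the constant in `‖M N‖ ≤ K ‖M‖ ‖N‖`: the modulus
itself is not submultiplicative. -/
def mulL (n : ℕ) : Cl n →L[ℝ] Cl n →L[ℝ] Cl n :=
  (LinearMap.mul ℝ (Cl n)).toContinuousBilinearMap

theorem norm_mul_le_opNorm (M N : Cl n) : ‖M * N‖ ≤ ‖mulL n‖ * ‖M‖ * ‖N‖ :=
  (mulL n).le_opNorm₂ M N

end Modulus

/-! ### The pseudoscalar -/

section Pseudoscalar

variable {n : ℕ}

theorem odd_choose_two (hn : n % 4 = 2 ∨ n % 4 = 3) : Odd (n.choose 2) := by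
  rw [Nat.odd_iff]
  have h : n * (n - 1) = 2 * n.choose 2 := by
    rw [Nat.choose_two_right, Nat.mul_div_cancel' (Nat.even_mul_pred_self n).two_dvd]
  obtain ⟨k, rfl | rfl⟩ : ∃ k, n = 4 * k + 2 ∨ n = 4 * k + 3 := ⟨n / 4, by omega⟩ <;> grind

theorem rev_pseudoscalar (hn : n % 4 = 2 ∨ n % 4 = 3) :
    rev (pseudoscalar n) = -pseudoscalar n := by
  rw [pseudoscalar, rev_blade, Finset.card_fin, (odd_choose_two hn).neg_one_pow]
  simp

theorem pseudoscalar_mul_self (hn : n % 4 = 2 ∨ n % 4 = 3) :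
    pseudoscalar n * pseudoscalar n = -1 := by
  have h : pseudoscalar n * rev (pseudoscalar n) = 1 := blade_mul_rev _
  rwa [rev_pseudoscalar hn, mul_neg, neg_eq_iff_eq_neg] at h

theorem pseudoscalar_mul_stdVec (i : Fin n) :
    pseudoscalar n * stdVec i = (-1 : ℤˣ) ^ (n + 1) • (stdVec i * pseudoscalar n) := by
  obtain ⟨s, hs⟩ := stdVec_mul_blade_of_notMem (Finset.notMem_erase i Finset.univ)
  rw [Finset.insert_erase (Finset.mem_univ i), ← inv_smul_eq_iff] at hs
  rw [pseudoscalar, ← hs, smul_mul_assoc, mul_assoc,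
    blade_mul_stdVec_of_notMem (Finset.notMem_erase i _),
    Finset.card_erase_of_mem (Finset.mem_univ i), Finset.card_fin]
  have parity : (-1 : ℤˣ) ^ (n - 1) = (-1) ^ (n + 1) := by
    obtain ⟨m, rfl⟩ : ∃ m, n = m + 1 := ⟨n - 1, by have := i.pos; omega⟩
    simp [pow_succ]
  simp only [mul_smul_comm, parity]
  rw [smul_comm]

theorem pseudoscalar_mul_ι (v : E n) :
    pseudoscalar n * CliffordAlgebra.ι (quadForm n) v =
      (-1 : ℤˣ) ^ (n + 1) • (CliffordAlgebra.ι (quadForm n) v * pseudoscalar n) := by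
  rw [← (EuclideanSpace.basisFun (Fin n) ℝ).sum_repr v]
  simp only [map_sum, map_smul, Finset.mul_sum, Finset.sum_mul, Finset.smul_sum, mul_smul_comm,
    smul_mul_assoc, smul_comm _ (_ : ℝ)]
  exact Finset.sum_congr rfl fun i _ => congrArg _ (pseudoscalar_mul_stdVec i)

theorem pseudoscalar_mul_of_odd (hn : Odd n) (M : Cl n) :
    pseudoscalar n * M = M * pseudoscalar n := by
  induction M using CliffordAlgebra.induction with
  | algebraMap r => exact (Algebra.commutes r _).symm
  | ι v => rw [pseudoscalar_mul_ι, (hn.add_odd odd_one).neg_one_pow, one_smul]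
  | mul a b ha hb => rw [← mul_assoc, ha, mul_assoc, hb, mul_assoc]
  | add a b ha hb => rw [mul_add, add_mul, ha, hb]

theorem pseudoscalar_mul_of_even (hn : Even n) (M : Cl n) :
    pseudoscalar n * M = CliffordAlgebra.involute M * pseudoscalar n := by
  induction M using CliffordAlgebra.induction with
  | algebraMap r => rw [AlgHom.commutes]; exact (Algebra.commutes r _).symm
  | ι v =>
    rw [pseudoscalar_mul_ι, (hn.add_odd odd_one).neg_one_pow]
    simp
  | mul a b ha hb => rw [← mul_assoc, ha, mul_assoc, hb, map_mul, mul_assoc]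
  | add a b ha hb => rw [mul_add, map_add, add_mul, ha, hb]

end Pseudoscalar

/-! ### The exponential `e^{i_n t}` -/

section Exponential

theorem exp_smul_eq_cos_add_sin {A : Type*} [Ring A] [Algebra ℝ A] [TopologicalSpace A]
    [IsTopologicalRing A] [ContinuousSMul ℝ A] [T2Space A] {j : A} (hj : j * j = -1) (t : ℝ) :
    NormedSpace.exp (t • j) = Real.cos t • 1 + Real.sin t • j := by
  let φ : ℂ →ₐ[ℝ] A := Complex.lift ⟨j, hj⟩
  have φ_apply (z : ℂ) : φ z = z.re • 1 + z.im • j := by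
    simp [φ, Complex.liftAux_apply, Algebra.algebraMap_eq_smul_one]
  have φ_cont : Continuous φ := by
    simp only [funext φ_apply]
    fun_prop
  have h : HasSum _ (φ (NormedSpace.exp (t * Complex.I))) :=
    (NormedSpace.exp_series_hasSum_exp' (𝕂 := ℝ) (t * Complex.I : ℂ)).map φ φ_cont
  have φ_I : φ (t * Complex.I) = t • j := by simp [φ_apply]
  simp only [Function.comp_def, map_smul, map_pow, φ_I] at h
  simp only [← Complex.exp_eq_exp_ℂ, φ_apply, Complex.exp_ofReal_mul_I_re,
    Complex.exp_ofReal_mul_I_im] at h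
  rw [NormedSpace.exp_eq_tsum ℝ, ← h.tsum_eq]

variable {n : ℕ}

/-- The kernel `e^{i_n t}` of the Clifford Fourier transform. -/
def expI (t : ℝ) : Cl n := NormedSpace.exp (t • pseudoscalar n)

theorem expI_eq (hn : n % 4 = 2 ∨ n % 4 = 3) (t : ℝ) :
    (expI t : Cl n) = Real.cos t • 1 + Real.sin t • pseudoscalar n :=
  exp_smul_eq_cos_add_sin (pseudoscalar_mul_self hn) t

theorem expI_add (hn : n % 4 = 2 ∨ n % 4 = 3) (s t : ℝ) :
    (expI (s + t) : Cl n) = expI s * expI t := by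
  simp only [expI_eq hn, Real.cos_add, Real.sin_add, mul_add, add_mul, smul_mul_smul_comm, one_mul,
    mul_one, pseudoscalar_mul_self hn]
  module

@[simp] theorem expI_zero : (expI 0 : Cl n) = 1 := by simp [expI]

theorem expI_mul_expI_neg (hn : n % 4 = 2 ∨ n % 4 = 3) (t : ℝ) :
    (expI t : Cl n) * expI (-t) = 1 := by
  rw [← expI_add hn, add_neg_cancel, expI_zero]

theorem rev_expI (hn : n % 4 = 2 ∨ n % 4 = 3) (t : ℝ) : rev (expI t : Cl n) = expI (-t) := by
  simp [expI_eq hn, rev_pseudoscalar hn]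

theorem continuous_expI (hn : n % 4 = 2 ∨ n % 4 = 3) : Continuous (expI : ℝ → Cl n) := by
  simp only [funext (expI_eq hn)]
  fun_prop

theorem norm_mul_expI (hn : n % 4 = 2 ∨ n % 4 = 3) (M : Cl n) (t : ℝ) : ‖M * expI t‖ = ‖M‖ := by
  refine (sq_eq_sq₀ (norm_nonneg _) (norm_nonneg _)).1 ?_
  rw [← real_inner_self_eq_norm_sq, ← real_inner_self_eq_norm_sq, ← coord_empty_mul_rev,
    ← coord_empty_mul_rev, rev_mul, rev_expI hn, mul_assoc, ← mul_assoc (expI t),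
    expI_mul_expI_neg hn, one_mul]

end Exponential

/-! ### Multivectors that commute or anticommute with the pseudoscalar -/

section SignCommutes

variable {n : ℕ} {ε : ℤˣ} {M : Cl n}

/-- `M` commutes (`ε = 1`) or anticommutes (`ε = -1`) with the pseudoscalar. -/
def SignCommutes (ε : ℤˣ) (M : Cl n) : Prop := pseudoscalar n * M = ε • (M * pseudoscalar n)

theorem SignCommutes.smul (hM : SignCommutes ε M) (c : ℝ) : SignCommutes ε (c • M) := by
  rw [SignCommutes, mul_smul_comm, hM, smul_mul_assoc, smul_comm]

theorem SignCommutes.expI_mul (hn : n % 4 = 2 ∨ n % 4 = 3) (hM : SignCommutes ε M) (t : ℝ) :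
    expI t * M = M * expI (ε • t) := by
  rw [expI_eq hn, expI_eq hn, add_mul, mul_add, smul_mul_assoc, smul_mul_assoc, hM]
  rcases Int.units_eq_one_or ε with rfl | rfl <;> simp

theorem SignCommutes.rev (hn : n % 4 = 2 ∨ n % 4 = 3) (hM : SignCommutes ε M) :
    SignCommutes ε (rev M) := by
  have h := congrArg CliffordWavelet.rev hM
  rw [SignCommutes]
  rcases Int.units_eq_one_or ε with rfl | rfl
  · simpa [rev_pseudoscalar hn] using h.symm
  · simpa [rev_pseudoscalar hn, neg_eq_iff_eq_neg] using congrArg Neg.neg h.symm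

theorem SignCommutes.commute_rev_mul (hn : n % 4 = 2 ∨ n % 4 = 3) (hM : SignCommutes ε M) :
    Commute (pseudoscalar n) (CliffordWavelet.rev M * M) := by
  rw [Commute, SemiconjBy, ← mul_assoc, hM.rev hn, smul_mul_assoc, mul_assoc, hM, mul_smul_comm,
    ← mul_smul, Int.units_mul_self, one_smul, mul_assoc]

end SignCommutes

/-! ### Plancherel's theorem on `L¹ ∩ L²` -/

section Plancherel

open FourierTransform SchwartzMap
open scoped ContDiff

variable {V H : Type*} [NormedAddCommGroup V] [InnerProductSpace ℝ V] [FiniteDimensional ℝ V]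
  [MeasurableSpace V] [BorelSpace V] [NormedAddCommGroup H] [InnerProductSpace ℂ H]
  [CompleteSpace H] {f : V → H}

theorem fourier_toLp_ae_eq (h₁ : Integrable f) (h₂ : MemLp f 2) :
    ((𝓕 (h₂.toLp f) : Lp H 2 (volume : Measure V)) : V → H) =ᵐ[volume] 𝓕 f := by
  have fourier_cont : Continuous (𝓕 f) :=
    VectorFourier.fourierIntegral_continuous Real.continuous_fourierChar
      (by exact continuous_inner) h₁
  refine ae_eq_of_integral_contDiff_smul_eq ((Lp.memLp _).locallyIntegrable (by norm_num))
    fourier_cont.locallyIntegrable fun g hg hgc => ?_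
  let φ : 𝓢(V, ℂ) := (hgc.comp_left (g := Complex.ofRealCLM) rfl).toSchwartzMap
    (by fun_prop : ContDiff ℝ ∞ (Complex.ofRealCLM ∘ g))
  have φ_smul (x : V) (v : H) : g x • v = φ x • v := (Complex.coe_smul (g x) v).symm
  have multiplication_formula : ∫ x, φ x • 𝓕 f x = ∫ x, (𝓕 φ) x • f x := by
    have h := VectorFourier.integral_fourierIntegral_smul_eq_flip (L := innerₗ V)
      (μ := (volume : Measure V)) (ν := (volume : Measure V)) (f := φ) (g := f)
      Real.continuous_fourierChar (by exact continuous_inner) φ.integrable h₁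
    rw [flip_innerₗ] at h
    exact h.symm
  simp only [φ_smul]
  rw [multiplication_formula, ← Lp.toTemperedDistribution_apply,
    ← Lp.fourier_toTemperedDistribution_eq, TemperedDistribution.fourier_apply,
    Lp.toTemperedDistribution_apply]
  refine integral_congr_ae ?_
  filter_upwards [h₂.coeFn_toLp] with x hx
  rw [hx]

theorem eLpNorm_fourier (h₁ : Integrable f) (h₂ : MemLp f 2) :
    eLpNorm (𝓕 f) 2 = eLpNorm f 2 := by
  rw [← eLpNorm_congr_ae (fourier_toLp_ae_eq h₁ h₂), ← eLpNorm_congr_ae h₂.coeFn_toLp,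
    ← ENNReal.toReal_eq_toReal_iff' (Lp.eLpNorm_ne_top _) (Lp.eLpNorm_ne_top _), ← Lp.norm_def,
    ← Lp.norm_def, Lp.norm_fourier_eq]

end Plancherel

/-! ### Dilations and truncations in `Lᵖ` -/

section Lp

variable {V X : Type*} [NormedAddCommGroup V] [MeasurableSpace V] [BorelSpace V]
  [NormedAddCommGroup X] {p : ENNReal}

theorem eLpNorm_comp_smul [NormedSpace ℝ V] [FiniteDimensional ℝ V] {μ : Measure V}
    [μ.IsAddHaarMeasure] (hp : p ≠ ⊤) {s : ℝ} (hs : s ≠ 0) (f : V → X) :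
    eLpNorm (fun x => f (s • x)) p μ =
      ENNReal.ofReal |(s ^ Module.finrank ℝ V)⁻¹| ^ (1 / p).toReal * eLpNorm f p μ := by
  have h : eLpNorm f p (μ.map (s • ·)) = eLpNorm (fun x => f (s • x)) p μ :=
    (Homeomorph.smulOfNeZero s hs).measurableEmbedding.eLpNorm_map_measure
  rw [← h, Measure.map_addHaar_smul μ hs, eLpNorm_smul_measure_of_ne_top hp, smul_eq_mul]

/-- The restriction of `f` to the ball of radius `R`, extended by zero. -/
def truncate (f : V → X) (R : ℝ) : V → X := (Metric.ball (0 : V) R).indicator f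

theorem memLp_truncate {μ : Measure V} {f : V → X} (hf : MemLp f p μ) (R : ℝ) :
    MemLp (truncate f R) p μ :=
  hf.indicator measurableSet_ball

theorem integrable_truncate [ProperSpace V] {μ : Measure V} [IsFiniteMeasureOnCompacts μ]
    (hp : 1 ≤ p) {f : V → X} (hf : MemLp f p μ) (R : ℝ) : Integrable (truncate f R) μ := by
  have : IsFiniteMeasure (μ.restrict (Metric.ball (0 : V) R)) :=
    ⟨by simpa using measure_ball_lt_top⟩
  exact (integrable_indicator_iff measurableSet_ball).2 ((hf.restrict _).integrable hp)

theorem tendsto_eLpNorm_sub_truncate {μ : Measure V} (hp : p ≠ ⊤) {f : V → X}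
    (hf : MemLp f p μ) : Tendsto (fun R : ℝ => eLpNorm (f - truncate f R) p μ) atTop (𝓝 0) := by
  obtain rfl | hp₀ := eq_or_ne p 0
  · simp
  have dominated : Tendsto (fun R : ℝ => ∫⁻ x, ‖(f - truncate f R) x‖ₑ ^ p.toReal ∂μ) atTop
      (𝓝 (∫⁻ _, 0 ∂μ)) := by
    refine tendsto_of_seq_tendsto fun R hR => ?_
    refine tendsto_lintegral_of_dominated_convergence' (fun x => ‖f x‖ₑ ^ p.toReal)
      (fun k => ((hf.1.sub (memLp_truncate hf (R k)).1).enorm).pow_const _)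
      (fun k => ae_of_all _ fun x => ?_)
      (lintegral_rpow_enorm_lt_top_of_eLpNorm_lt_top hp₀ hp hf.2).ne (ae_of_all _ fun x => ?_)
    · refine ENNReal.rpow_le_rpow ?_ ENNReal.toReal_nonneg
      by_cases hx : x ∈ Metric.ball (0 : V) (R k)
      · simp [truncate, Set.indicator_of_mem hx]
      · simp [truncate, Set.indicator_of_notMem hx]
    · refine tendsto_const_nhds.congr' ?_
      filter_upwards [hR.eventually_gt_atTop ‖x‖] with k hk
      have hx : x ∈ Metric.ball (0 : V) (R k) := by simpa using hk
      simp [truncate, Set.indicator_of_mem hx, ENNReal.toReal_pos hp₀ hp]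
  rw [lintegral_zero] at dominated
  have h := ((ENNReal.continuous_rpow_const (y := 1 / p.toReal)).tendsto 0).comp dominated
  simp_rw [eLpNorm_eq_lintegral_rpow_enorm_toReal hp₀ hp]
  simpa [Function.comp_def, ENNReal.toReal_pos hp₀ hp] using h

theorem tendsto_eLpNorm_of_tendsto_eLpNorm_sub {α ι : Type*} [MeasurableSpace α] {μ : Measure α}
    {l : Filter ι} [Fact (1 ≤ p)] {F : α → X} {G : ι → α → X} (hF : MemLp F p μ)
    (hG : ∀ k, MemLp (G k) p μ) (h : Tendsto (fun k => eLpNorm (F - G k) p μ) l (𝓝 0)) :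
    Tendsto (fun k => eLpNorm (G k) p μ) l (𝓝 (eLpNorm F p μ)) := by
  have hLp : Tendsto (fun k => (hG k).toLp (G k)) l (𝓝 (hF.toLp F)) := by
    refine (Lp.tendsto_Lp_iff_tendsto_eLpNorm'' G hG F hF).2 ?_
    simpa only [eLpNorm_sub_comm] using h
  simpa [Function.comp_def, Lp.enorm_toLp] using (continuous_enorm.tendsto _).comp hLp

end Lp

/-! ### The Clifford Fourier integral -/

section CFTIntegral

variable {n : ℕ} {f g : E n → Cl n}

/-- The Clifford Fourier integral `∫ f(x) e^{-i_n ω·x} dⁿx`. -/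
def cftIntegral (f : E n → Cl n) (ω : E n) : Cl n := ∫ x, f x * expI (-inner ℝ ω x)

/-- The constant `(2π)^{n/2}` in Plancherel's identity. -/
def plancherelConst (n : ℕ) : NNReal := NNReal.sqrt ((2 * NNReal.pi) ^ n)

theorem plancherelConst_sq (n : ℕ) : (plancherelConst n : ℝ) ^ 2 = (2 * Real.pi) ^ n := by
  rw [← NNReal.coe_pow, plancherelConst, NNReal.sq_sqrt]
  simp

/-- The embedding `M ↦ (M_A - i (M i_n)_A)_A` of `Cl_n` into a complex Hilbert space. It turns right
multiplication by `i_n` into multiplication by `i`, hence the Clifford Fourier transform into the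
Fourier transform of vector-valued functions. -/
def complexCoords (n : ℕ) : Cl n →L[ℝ] EuclideanSpace ℂ (Finset (Fin n)) :=
  LinearMap.toContinuousLinearMap
    { toFun := fun M => WithLp.toLp 2 fun A => ⟨coord A M, -coord A (M * pseudoscalar n)⟩
      map_add' := fun M N => by
        ext A
        apply Complex.ext <;> simp [add_mul, add_comm]
      map_smul' := fun c M => by
        ext A
        apply Complex.ext <;> simp }

theorem complexCoords_apply (M : Cl n) (A : Finset (Fin n)) :
    complexCoords n M A = ⟨coord A M, -coord A (M * pseudoscalar n)⟩ := rfl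

theorem complexCoords_mul_expI (hn : n % 4 = 2 ∨ n % 4 = 3) (M : Cl n) (t : ℝ) :
    complexCoords n (M * expI t) = Complex.exp (t * Complex.I) • complexCoords n M := by
  have mul_expI : M * expI t = Real.cos t • M + Real.sin t • (M * pseudoscalar n) := by
    simp [expI_eq hn, mul_add]
  have mul_expI_mul : M * expI t * pseudoscalar n =
      Real.cos t • (M * pseudoscalar n) - Real.sin t • M := by
    rw [mul_expI, add_mul, smul_mul_assoc, smul_mul_assoc, mul_assoc, pseudoscalar_mul_self hn,
      mul_neg_one, smul_neg, sub_eq_add_neg]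
  ext A
  rw [PiLp.smul_apply, complexCoords_apply, complexCoords_apply, mul_expI_mul, mul_expI]
  apply Complex.ext
  · simp [Complex.exp_ofReal_mul_I_re, Complex.exp_ofReal_mul_I_im]
  · simp [Complex.exp_ofReal_mul_I_re, Complex.exp_ofReal_mul_I_im, sub_eq_add_neg, add_comm]

theorem norm_mul_pseudoscalar (hn : n % 4 = 2 ∨ n % 4 = 3) (M : Cl n) :
    ‖M * pseudoscalar n‖ = ‖M‖ := by
  simpa [expI_eq hn] using norm_mul_expI hn M (Real.pi / 2)

theorem norm_complexCoords (hn : n % 4 = 2 ∨ n % 4 = 3) (M : Cl n) :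
    ‖complexCoords n M‖ = √2 * ‖M‖ := by
  refine (sq_eq_sq₀ (norm_nonneg _) (by positivity)).1 ?_
  calc ‖complexCoords n M‖ ^ 2
      = ∑ A, (coord A M ^ 2 + coord A (M * pseudoscalar n) ^ 2) := by
        rw [EuclideanSpace.norm_sq_eq]
        refine Finset.sum_congr rfl fun A _ => ?_
        rw [← Complex.normSq_eq_norm_sq, complexCoords_apply, Complex.normSq_mk]
        ring
    _ = ‖M‖ ^ 2 + ‖M * pseudoscalar n‖ ^ 2 := by
        rw [Finset.sum_add_distrib, norm_sq_eq_sum_coord, norm_sq_eq_sum_coord]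
    _ = (√2 * ‖M‖) ^ 2 := by
        rw [norm_mul_pseudoscalar hn, mul_pow, Real.sq_sqrt zero_le_two, two_mul]

theorem eLpNorm_complexCoords_comp (hn : n % 4 = 2 ∨ n % 4 = 3) (f : E n → Cl n) :
    eLpNorm (fun x => complexCoords n (f x)) 2 = ENNReal.ofReal √2 * eLpNorm f 2 := by
  rw [← Real.enorm_of_nonneg (Real.sqrt_nonneg 2), ← eLpNorm_const_smul]
  refine eLpNorm_congr_norm_ae (ae_of_all _ fun x => ?_)
  rw [norm_complexCoords hn, Pi.smul_apply, norm_smul, Real.norm_of_nonneg (Real.sqrt_nonneg 2)]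

theorem integrable_mul_expI (hn : n % 4 = 2 ∨ n % 4 = 3) (hf : Integrable f) {φ : E n → ℝ}
    (hφ : Continuous φ) : Integrable fun x => f x * expI (φ x) :=
  hf.congr' (hf.1.mul ((continuous_expI hn).comp hφ).aestronglyMeasurable)
    (ae_of_all _ fun _ => (norm_mul_expI hn _ _).symm)

theorem aestronglyMeasurable_cftIntegral (hn : n % 4 = 2 ∨ n % 4 = 3)
    (hf : AEStronglyMeasurable f) : AEStronglyMeasurable (cftIntegral f) := by
  have kernel_cont : Continuous fun p : E n × E n => (expI (-inner ℝ p.1 p.2) : Cl n) :=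
    (continuous_expI hn).comp (by fun_prop)
  exact (hf.comp_snd.mul kernel_cont.aestronglyMeasurable).integral_prod_right'

theorem cftIntegral_sub (hn : n % 4 = 2 ∨ n % 4 = 3) (hf : Integrable f) (hg : Integrable g) :
    cftIntegral (f - g) = cftIntegral f - cftIntegral g := by
  ext1 ω
  simp only [cftIntegral, Pi.sub_apply, sub_mul]
  exact integral_sub (integrable_mul_expI hn hf (by fun_prop))
    (integrable_mul_expI hn hg (by fun_prop))

open FourierTransform in
theorem complexCoords_cftIntegral (hn : n % 4 = 2 ∨ n % 4 = 3) (hf : Integrable f) (ω : E n) :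
    complexCoords n (cftIntegral f ω) =
      𝓕 (fun x => complexCoords n (f x)) ((2 * Real.pi)⁻¹ • ω) := by
  rw [cftIntegral, Real.fourier_eq',
    ← ContinuousLinearMap.integral_comp_comm _ (integrable_mul_expI hn hf (by fun_prop))]
  refine integral_congr_ae (ae_of_all _ fun x => ?_)
  have phase : -inner ℝ ω x = -2 * Real.pi * inner ℝ x ((2 * Real.pi)⁻¹ • ω) := by
    rw [inner_smul_right, real_inner_comm]
    field_simp
  simp only [complexCoords_mul_expI hn, phase]

theorem eLpNorm_cftIntegral (hn : n % 4 = 2 ∨ n % 4 = 3) (h₁ : Integrable f) (h₂ : MemLp f 2) :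
    eLpNorm (cftIntegral f) 2 = plancherelConst n * eLpNorm f 2 := by
  have dilation_const : ENNReal.ofReal |((2 * Real.pi)⁻¹ ^ n)⁻¹| ^ (1 / 2 : ENNReal).toReal =
      plancherelConst n := by
    rw [inv_pow, inv_inv, abs_of_nonneg (by positivity), plancherelConst, NNReal.sqrt_eq_rpow,
      ENNReal.coe_rpow_of_nonneg _ (by norm_num), ENNReal.ofReal, Real.toNNReal_of_nonneg
        (by positivity)]
    norm_num
    rfl
  have h := eLpNorm_comp_smul (V := E n) (μ := volume) (p := 2) (by norm_num)
    (inv_ne_zero Real.two_pi_pos.ne') (FourierTransform.fourier fun x => complexCoords n (f x))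
  rw [finrank_euclideanSpace_fin, dilation_const,
    eLpNorm_fourier ((complexCoords n).integrable_comp h₁) ((complexCoords n).comp_memLp' h₂)] at h
  simp only [← complexCoords_cftIntegral hn h₁] at h
  rw [eLpNorm_complexCoords_comp hn, eLpNorm_complexCoords_comp hn, mul_left_comm] at h
  exact (ENNReal.mul_right_inj (by simp) ENNReal.ofReal_ne_top).1 h

theorem memLp_cftIntegral (hn : n % 4 = 2 ∨ n % 4 = 3) (h₁ : Integrable f) (h₂ : MemLp f 2) :
    MemLp (cftIntegral f) 2 :=
  ⟨aestronglyMeasurable_cftIntegral hn h₁.1, by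
    rw [eLpNorm_cftIntegral hn h₁ h₂]
    exact ENNReal.mul_lt_top ENNReal.coe_lt_top h₂.2⟩

theorem eLpNorm_cftIntegral_sub (hn : n % 4 = 2 ∨ n % 4 = 3) (hf : Integrable f)
    (hf' : MemLp f 2) (hg : Integrable g) (hg' : MemLp g 2) :
    eLpNorm (cftIntegral f - cftIntegral g) 2 = plancherelConst n * eLpNorm (f - g) 2 := by
  rw [← cftIntegral_sub hn hf hg, eLpNorm_cftIntegral hn (hf.sub hg) (hf'.sub hg')]

end CFTIntegral

/-! ### The Clifford Fourier transform on `L²` -/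

section IsCFT

variable {n : ℕ} {f F g G : E n → Cl n}

theorem setIntegral_ball_eq_cftIntegral (f : E n → Cl n) (R : ℝ) (ω : E n) :
    ∫ x in Metric.ball (0 : E n) R, f x * NormedSpace.exp (-(inner ℝ ω x) • pseudoscalar n) =
      cftIntegral (truncate f R) ω := by
  rw [cftIntegral, ← integral_indicator measurableSet_ball]
  refine integral_congr_ae (ae_of_all _ fun x => ?_)
  by_cases hx : x ∈ Metric.ball (0 : E n) R
  · simp only [truncate, Set.indicator_of_mem hx, expI]
  · simp only [truncate, Set.indicator_of_notMem hx, zero_mul]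

theorem isCFT_iff : IsCFT f F ↔ MemLp F 2 ∧
    Tendsto (fun R : ℝ => eLpNorm (F - cftIntegral (truncate f R)) 2) atTop (𝓝 0) := by
  have h (R : ℝ) : (fun ω => F ω - ∫ x in Metric.ball (0 : E n) R,
      f x * NormedSpace.exp (-(inner ℝ ω x) • pseudoscalar n)) =
      F - cftIntegral (truncate f R) := by
    simp only [setIntegral_ball_eq_cftIntegral, Pi.sub_def]
  refine ⟨fun hF => ⟨hF.memLp, ?_⟩, fun hF => ⟨hF.1, ?_⟩⟩
  · simpa only [h] using hF.tendsto
  · simpa only [h] using hF.2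

section Approximation

variable {ι : Type*} {l : Filter ι} [l.NeBot] {φ : ι → E n → Cl n}

theorem eLpNorm_eq_of_tendsto_cftIntegral (hn : n % 4 = 2 ∨ n % 4 = 3) (hf : MemLp f 2)
    (hF : MemLp F 2) (h₁ : ∀ k, Integrable (φ k)) (h₂ : ∀ k, MemLp (φ k) 2)
    (hφ : Tendsto (fun k => eLpNorm (f - φ k) 2) l (𝓝 0))
    (hφF : Tendsto (fun k => eLpNorm (F - cftIntegral (φ k)) 2) l (𝓝 0)) :
    eLpNorm F 2 = plancherelConst n * eLpNorm f 2 := by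
  have norm_cft := tendsto_eLpNorm_of_tendsto_eLpNorm_sub hF
    (fun k => memLp_cftIntegral hn (h₁ k) (h₂ k)) hφF
  simp only [fun k => eLpNorm_cftIntegral hn (h₁ k) (h₂ k)] at norm_cft
  exact tendsto_nhds_unique norm_cft <| ENNReal.Tendsto.const_mul
    (tendsto_eLpNorm_of_tendsto_eLpNorm_sub hf h₂ hφ) (Or.inr ENNReal.coe_ne_top)

theorem isCFT_of_tendsto (hn : n % 4 = 2 ∨ n % 4 = 3) (hf : MemLp f 2) (hF : MemLp F 2)
    (h₁ : ∀ k, Integrable (φ k)) (h₂ : ∀ k, MemLp (φ k) 2)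
    (hφ : Tendsto (fun k => eLpNorm (f - φ k) 2) l (𝓝 0))
    (hφF : Tendsto (fun k => eLpNorm (F - cftIntegral (φ k)) 2) l (𝓝 0)) : IsCFT f F := by
  have norm_sub_truncate (R : ℝ) : eLpNorm (F - cftIntegral (truncate f R)) 2 =
      plancherelConst n * eLpNorm (f - truncate f R) 2 := by
    have i₁ : Integrable (truncate f R) := integrable_truncate one_le_two hf R
    have i₂ : MemLp (truncate f R) 2 := memLp_truncate hf R
    refine eLpNorm_eq_of_tendsto_cftIntegral (l := l) (φ := fun k => φ k - truncate f R) hn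
      (hf.sub i₂) (hF.sub (memLp_cftIntegral hn i₁ i₂))
      (fun k => (h₁ k).sub i₁) (fun k => (h₂ k).sub i₂) ?_ ?_
    · simpa only [sub_sub_sub_cancel_right] using hφ
    · simpa only [cftIntegral_sub hn (h₁ _) i₁, sub_sub_sub_cancel_right] using hφF
  refine isCFT_iff.2 ⟨hF, ?_⟩
  simpa only [norm_sub_truncate, mul_zero] using ENNReal.Tendsto.const_mul
    (tendsto_eLpNorm_sub_truncate (by norm_num) hf) (Or.inr ENNReal.coe_ne_top)

end Approximation

theorem isCFT_cftIntegral (hn : n % 4 = 2 ∨ n % 4 = 3) (h₁ : Integrable f) (h₂ : MemLp f 2) :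
    IsCFT f (cftIntegral f) :=
  isCFT_of_tendsto hn (l := (⊤ : Filter Unit)) (φ := fun _ => f) h₂ (memLp_cftIntegral hn h₁ h₂)
    (fun _ => h₁) (fun _ => h₂) (by simp) (by simp)

theorem exists_isCFT (hn : n % 4 = 2 ∨ n % 4 = 3) (hf : MemLp f 2) : ∃ F, IsCFT f F := by
  have i₁ (R : ℝ) : Integrable (truncate f R) := integrable_truncate one_le_two hf R
  have i₂ (R : ℝ) : MemLp (truncate f R) 2 := memLp_truncate hf R
  have hcft (R : ℝ) := memLp_cftIntegral hn (i₁ R) (i₂ R)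
  have truncate_tendsto :
      Tendsto (fun R => (i₂ R).toLp (truncate f R)) atTop (𝓝 (hf.toLp f)) := by
    refine (Lp.tendsto_Lp_iff_tendsto_eLpNorm'' _ i₂ f hf).2 ?_
    simpa only [eLpNorm_sub_comm] using tendsto_eLpNorm_sub_truncate (by norm_num) hf
  have cft_cauchy : CauchySeq fun R => (hcft R).toLp (cftIntegral (truncate f R)) := by
    have h := truncate_tendsto.cauchySeq
    rw [EMetric.cauchySeq_iff] at h ⊢
    intro δ hδ
    obtain ⟨N, hN⟩ := h (δ / plancherelConst n) (ENNReal.div_pos hδ.ne' ENNReal.coe_ne_top)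
    refine ⟨N, fun R hR S hS => ?_⟩
    have hRS := hN R hR S hS
    rw [Lp.edist_toLp_toLp] at hRS ⊢
    rw [eLpNorm_cftIntegral_sub hn (i₁ R) (i₂ R) (i₁ S) (i₂ S), mul_comm]
    exact ENNReal.mul_lt_of_lt_div hRS
  obtain ⟨F, hF⟩ := cauchySeq_tendsto_of_complete cft_cauchy
  refine ⟨F, isCFT_iff.2 ⟨Lp.memLp F, ?_⟩⟩
  rw [← Lp.toLp_coeFn F (Lp.memLp F), Lp.tendsto_Lp_iff_tendsto_eLpNorm''] at hF
  simpa only [eLpNorm_sub_comm] using hF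

namespace IsCFT

theorem eLpNorm_eq (hn : n % 4 = 2 ∨ n % 4 = 3) (hf : MemLp f 2) (h : IsCFT f F) :
    eLpNorm F 2 = plancherelConst n * eLpNorm f 2 :=
  eLpNorm_eq_of_tendsto_cftIntegral hn hf h.memLp (integrable_truncate one_le_two hf)
    (memLp_truncate hf) (tendsto_eLpNorm_sub_truncate (by norm_num) hf) (isCFT_iff.1 h).2

theorem sub (hn : n % 4 = 2 ∨ n % 4 = 3) (hf : MemLp f 2) (hg : MemLp g 2) (hF : IsCFT f F)
    (hG : IsCFT g G) : IsCFT (f - g) (F - G) := by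
  refine isCFT_iff.2 ⟨hF.memLp.sub hG.memLp, ?_⟩
  refine tendsto_of_tendsto_of_tendsto_of_le_of_le tendsto_const_nhds
    (by simpa using (isCFT_iff.1 hF).2.add (isCFT_iff.1 hG).2) (fun _ => zero_le) fun R => ?_
  have if₁ : Integrable (truncate f R) := integrable_truncate one_le_two hf R
  have ig₁ : Integrable (truncate g R) := integrable_truncate one_le_two hg R
  have truncate_sub : truncate (f - g) R = truncate f R - truncate g R := Set.indicator_sub' ..
  dsimp only
  rw [truncate_sub, cftIntegral_sub hn if₁ ig₁, sub_sub_sub_comm]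
  exact eLpNorm_sub_le (hF.memLp.sub (memLp_cftIntegral hn if₁ (memLp_truncate hf R))).1
    (hG.memLp.sub (memLp_cftIntegral hn ig₁ (memLp_truncate hg R))).1 one_le_two

end IsCFT

/-- `U` is subtractive and bounded on `L²(ℝⁿ; Cl_n)`. As `U` acts on functions rather than on their
classes, homogeneity and measurability are not part of the definition. -/
structure IsL2Bounded (U : (E n → Cl n) → E n → Cl n) : Prop where
  memLp : ∀ {f}, MemLp f 2 → MemLp (U f) 2
  sub : ∀ f g, U (f - g) = U f - U g
  bound : ∃ K : NNReal, ∀ {f}, MemLp f 2 → eLpNorm (U f) 2 ≤ K * eLpNorm f 2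

theorem IsL2Bounded.tendsto {U : (E n → Cl n) → E n → Cl n} (hU : IsL2Bounded U) {ι : Type*}
    {l : Filter ι} {φ : ι → E n → Cl n} (hf : MemLp f 2) (hφ : ∀ k, MemLp (φ k) 2)
    (h : Tendsto (fun k => eLpNorm (f - φ k) 2) l (𝓝 0)) :
    Tendsto (fun k => eLpNorm (U f - U (φ k)) 2) l (𝓝 0) := by
  obtain ⟨K, hK⟩ := hU.bound
  refine tendsto_of_tendsto_of_tendsto_of_le_of_le tendsto_const_nhds
    (by simpa using ENNReal.Tendsto.const_mul (a := K) h (Or.inr ENNReal.coe_ne_top))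
    (fun _ => zero_le) fun k => ?_
  simpa only [hU.sub] using hK (hf.sub (hφ k))

theorem IsCFT.intertwine (hn : n % 4 = 2 ∨ n % 4 = 3) (hf : MemLp f 2) (h : IsCFT f F)
    {U V : (E n → Cl n) → E n → Cl n} (hU : IsL2Bounded U) (hV : IsL2Bounded V)
    (hU₁ : ∀ φ, Integrable φ → Integrable (U φ))
    (hUV : ∀ φ, Integrable φ → cftIntegral (U φ) = V (cftIntegral φ)) : IsCFT (U f) (V F) := by
  have i₁ (R : ℝ) : Integrable (truncate f R) := integrable_truncate one_le_two hf R
  have i₂ (R : ℝ) : MemLp (truncate f R) 2 := memLp_truncate hf R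
  refine isCFT_of_tendsto hn (l := atTop) (φ := fun R => U (truncate f R)) (hU.memLp hf)
    (hV.memLp h.memLp) (fun R => hU₁ _ (i₁ R)) (fun R => hU.memLp (i₂ R))
    (hU.tendsto hf i₂ (tendsto_eLpNorm_sub_truncate (by norm_num) hf)) ?_
  simpa only [hUV _ (i₁ _)] using
    hV.tendsto h.memLp (fun R => memLp_cftIntegral hn (i₁ R) (i₂ R)) (isCFT_iff.1 h).2

theorem isL2Bounded_clm_comp (L : Cl n →L[ℝ] Cl n) : IsL2Bounded fun f x => L (f x) where
  memLp hf := L.comp_memLp' hf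
  sub f g := by
    ext1 x
    simp
  bound := ⟨‖L‖₊, fun _ => eLpNorm_le_nnreal_smul_eLpNorm_of_ae_le_mul
    (ae_of_all _ fun _ => L.le_opNNNorm _) 2⟩

theorem IsCFT.clm_comp (hn : n % 4 = 2 ∨ n % 4 = 3) (hf : MemLp f 2) (h : IsCFT f F)
    {L : Cl n →L[ℝ] Cl n} (hL : ∀ M t, L (M * expI t) = L M * expI t) :
    IsCFT (fun x => L (f x)) (fun ω => L (F ω)) := by
  refine h.intertwine hn hf (isL2Bounded_clm_comp L) (isL2Bounded_clm_comp L)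
    (fun φ hφ => L.integrable_comp hφ) fun φ hφ => funext fun ω => ?_
  simp only [cftIntegral, ← hL]
  exact L.integral_comp_comm (integrable_mul_expI hn hφ (by fun_prop))

end IsCFT

/-! ### Parseval's identity -/

section Parseval

variable {n : ℕ}

theorem integrable_mul_of_memLp_two {X : Type*} [MeasurableSpace X] {μ : Measure X}
    {f g : X → Cl n} (hf : MemLp f 2 μ) (hg : MemLp g 2 μ) : Integrable (fun x => f x * g x) μ :=
  memLp_one_iff_integrable.1 ((mulL n).memLp_of_bilin 1 hf hg)

theorem integrable_mul_rev {X : Type*} [MeasurableSpace X] {μ : Measure X} {f g : X → Cl n}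
    (hf : MemLp f 2 μ) (hg : MemLp g 2 μ) : Integrable (fun x => f x * rev (g x)) μ :=
  integrable_mul_of_memLp_two hf ((revL n).comp_memLp' hg)

theorem integral_norm_sq_eq_eLpNorm {X H : Type*} [MeasurableSpace X] {μ : Measure X}
    [NormedAddCommGroup H] {f : X → H} (hf : MemLp f 2 μ) :
    ∫ x, ‖f x‖ ^ 2 ∂μ = (eLpNorm f 2 μ).toReal ^ 2 := by
  rw [hf.eLpNorm_eq_integral_rpow_norm (by norm_num) (by norm_num),
    ENNReal.toReal_ofReal (by positivity), ← Real.rpow_natCast, ← Real.rpow_mul (by positivity)]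
  simp

theorem integral_inner_eq_eLpNorm {X H : Type*} [MeasurableSpace X] {μ : Measure X}
    [NormedAddCommGroup H] [InnerProductSpace ℝ H] {f g : X → H} (hf : MemLp f 2 μ)
    (hg : MemLp g 2 μ) :
    ∫ x, inner ℝ (f x) (g x) ∂μ = ((eLpNorm f 2 μ).toReal ^ 2 + (eLpNorm g 2 μ).toReal ^ 2 -
      (eLpNorm (f - g) 2 μ).toReal ^ 2) / 2 := by
  have hf' := hf.integrable_norm_pow two_ne_zero
  have hg' := hg.integrable_norm_pow two_ne_zero
  have hfg' := (hf.sub hg).integrable_norm_pow two_ne_zero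
  have hsum' : Integrable (fun x => ‖f x‖ ^ 2 + ‖g x‖ ^ 2) μ := hf'.add hg'
  rw [← integral_norm_sq_eq_eLpNorm hf, ← integral_norm_sq_eq_eLpNorm hg,
    ← integral_norm_sq_eq_eLpNorm (hf.sub hg), ← integral_add hf' hg',
    ← integral_sub hsum' hfg', ← integral_div]
  refine integral_congr_ae (ae_of_all _ fun x => ?_)
  simp only [Pi.sub_apply, sq,
    real_inner_eq_norm_mul_self_add_norm_mul_self_sub_norm_sub_mul_self_div_two]

variable {f F g G : E n → Cl n}

theorem IsCFT.integral_inner (hn : n % 4 = 2 ∨ n % 4 = 3) (hf : MemLp f 2) (hg : MemLp g 2)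
    (hF : IsCFT f F) (hG : IsCFT g G) :
    ∫ ω, inner ℝ (F ω) (G ω) = (2 * Real.pi) ^ n * ∫ x, inner ℝ (f x) (g x) := by
  rw [integral_inner_eq_eLpNorm hF.memLp hG.memLp, integral_inner_eq_eLpNorm hf hg,
    hF.eLpNorm_eq hn hf, hG.eLpNorm_eq hn hg, (hF.sub hn hf hg hG).eLpNorm_eq hn (hf.sub hg)]
  simp only [ENNReal.toReal_mul, ENNReal.coe_toReal, mul_pow, plancherelConst_sq]
  ring

theorem IsCFT.integral_mul_rev (hn : n % 4 = 2 ∨ n % 4 = 3) (hf : MemLp f 2) (hg : MemLp g 2)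
    (hF : IsCFT f F) (hG : IsCFT g G) :
    ∫ ω, F ω * rev (G ω) = (2 * Real.pi) ^ n • ∫ x, f x * rev (g x) := by
  refine ext_coord fun A => ?_
  have hAG : IsCFT (fun x => mulL n (blade A) (g x)) fun ω => mulL n (blade A) (G ω) :=
    hG.clm_comp hn hg fun M t => (mul_assoc (blade A) M (expI t)).symm
  have hAg : MemLp (fun x => mulL n (blade A) (g x)) 2 := (mulL n (blade A)).comp_memLp' hg
  rw [map_smul, smul_eq_mul, ← (coord A).integral_comp_comm (integrable_mul_rev hF.memLp hG.memLp),
    ← (coord A).integral_comp_comm (integrable_mul_rev hf hg)]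
  simp only [coord_mul_rev]
  exact hF.integral_inner hn hf hAg hAG

end Parseval

/-! ### Rotations, dilations and translations -/

section Rotation

variable {n : ℕ}

theorem SO.coe_inv (r : SO n) :
    ((r⁻¹ : SO n) : Matrix (Fin n) (Fin n) ℝ) = (r : Matrix (Fin n) (Fin n) ℝ).transpose := rfl

theorem rot_mul (r s : SO n) (x : E n) : rot (r * s) x = rot r (rot s x) := by
  simp [rot, Matrix.toLpLin_apply]

@[simp] theorem rot_one (x : E n) : rot (1 : SO n) x = x := by simp [rot]

@[simp] theorem rot_inv_rot (r : SO n) (x : E n) : rot r⁻¹ (rot r x) = x := by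
  rw [← rot_mul, inv_mul_cancel, rot_one]

theorem inner_rot_left (r : SO n) (x y : E n) : inner ℝ (rot r x) y = inner ℝ x (rot r⁻¹ y) := by
  have adjoint_eq := Matrix.toEuclideanLin_conjTranspose_eq_adjoint (r : Matrix (Fin n) (Fin n) ℝ)
  rw [Matrix.conjTranspose_eq_transpose_of_trivial] at adjoint_eq
  rw [rot, rot, SO.coe_inv, adjoint_eq, LinearMap.adjoint_inner_right]

@[simp] theorem inner_rot_rot (r : SO n) (x y : E n) :
    inner ℝ (rot r x) (rot r y) = inner ℝ x y := by
  rw [inner_rot_left, rot_inv_rot]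

theorem rot_smul (r : SO n) (c : ℝ) (x : E n) : rot r (c • x) = c • rot r x :=
  map_smul (Matrix.toEuclideanLin (r : Matrix (Fin n) (Fin n) ℝ)) c x

/-- The action of a rotation, as a linear isometry. -/
def rotEquiv (r : SO n) : E n ≃ₗᵢ[ℝ] E n where
  toFun := rot r
  map_add' := map_add (Matrix.toEuclideanLin (r : Matrix (Fin n) (Fin n) ℝ))
  map_smul' := rot_smul r
  invFun := rot r⁻¹
  left_inv := rot_inv_rot r
  right_inv x := by simpa using rot_inv_rot r⁻¹ x
  norm_map' x := by
    change ‖rot r x‖ = ‖x‖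
    rw [norm_eq_sqrt_real_inner, inner_rot_rot, ← norm_eq_sqrt_real_inner]

theorem measurePreserving_rot (r : SO n) : MeasurePreserving (rot r) :=
  (rotEquiv r).measurePreserving

theorem measurableEmbedding_rot (r : SO n) : MeasurableEmbedding (rot r) :=
  (rotEquiv r).toHomeomorph.measurableEmbedding

theorem continuous_rot_inv : Continuous fun p : SO n × E n => rot p.1⁻¹ p.2 := by
  simp only [rot, SO.coe_inv, Matrix.toLpLin_apply]
  exact (PiLp.continuous_toLp 2 _).comp <| Continuous.matrix_mulVec
    (continuous_subtype_val.comp continuous_fst).matrix_transpose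
    ((PiLp.continuous_ofLp 2 _).comp continuous_snd)

instance instCompactSpaceSO (n : ℕ) : CompactSpace (SO n) := by
  have closed :
      IsClosed (Matrix.specialOrthogonalGroup (Fin n) ℝ : Set (Matrix (Fin n) (Fin n) ℝ)) := by
    have h : (Matrix.specialOrthogonalGroup (Fin n) ℝ : Set (Matrix (Fin n) (Fin n) ℝ)) =
        {M | M * M.transpose = 1} ∩ {M | M.det = 1} := by
      ext M
      exact Matrix.mem_specialOrthogonalGroup_iff.trans
        (and_congr (Matrix.mem_orthogonalGroup_iff _ _) Iff.rfl)
    rw [h]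
    exact (isClosed_eq (by fun_prop) continuous_const).inter
      (isClosed_eq (by fun_prop) continuous_const)
  have box_compact : IsCompact (Set.univ.pi fun _ : Fin n => Set.univ.pi fun _ : Fin n =>
      Metric.closedBall (0 : ℝ) 1) :=
    isCompact_univ_pi fun _ => isCompact_univ_pi fun _ => isCompact_closedBall 0 1
  refine isCompact_iff_compactSpace.1 (box_compact.of_isClosed_subset closed fun M hM i _ j _ => ?_)
  rw [mem_closedBall_zero_iff]
  exact entry_norm_bound_of_unitary (Matrix.mem_specialOrthogonalGroup_iff.1 hM).1 i j

end Rotation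

section DilRot

variable {n : ℕ} {q : ℝ × SO n} {f F : E n → Cl n}

/-- The unitary action `f ↦ a^{n/2} f(a r⁻¹ x)` of a dilation and a rotation on `L²(ℝⁿ; Cl_n)`. The
daughter wavelets use the dilation by `a⁻¹`, their Clifford Fourier transforms the one by `a`. -/
def dilRot (q : ℝ × SO n) (f : E n → Cl n) (x : E n) : Cl n :=
  q.1 ^ ((n : ℝ) / 2) • f (q.1 • rot q.2⁻¹ x)

theorem quasiMeasurePreserving_dilRot (hq : q.1 ≠ 0) :
    Measure.QuasiMeasurePreserving fun x : E n => q.1 • rot q.2⁻¹ x :=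
  (Measure.quasiMeasurePreserving_smul _ hq).comp
    (measurePreserving_rot q.2⁻¹).quasiMeasurePreserving

theorem integral_comp_smul_rot {X : Type*} [NormedAddCommGroup X] [NormedSpace ℝ X] (s : ℝ)
    (r : SO n) (g : E n → X) : ∫ x, g (s • rot r x) = |(s ^ n)⁻¹| • ∫ x, g x := by
  rw [(measurePreserving_rot r).integral_comp (measurableEmbedding_rot r) (fun x => g (s • x)),
    Measure.integral_comp_smul, finrank_euclideanSpace_fin]

theorem rpow_half_mul_self {a : ℝ} (ha : 0 ≤ a) (n : ℕ) :
    a ^ ((n : ℝ) / 2) * a ^ ((n : ℝ) / 2) = a ^ n := by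
  rw [← Real.rpow_add_of_nonneg ha (by positivity) (by positivity), add_halves, Real.rpow_natCast]

theorem eLpNorm_dilRot (hq : 0 < q.1) (f : E n → Cl n) :
    eLpNorm (dilRot q f) 2 = eLpNorm f 2 := by
  obtain ⟨a, r⟩ := q
  have ha : 0 < a := hq
  have scale :
      ‖a ^ ((n : ℝ) / 2)‖ₑ * ENNReal.ofReal |(a ^ n)⁻¹| ^ (1 / 2 : ENNReal).toReal = 1 := by
    have han : 0 < (a ^ n)⁻¹ := inv_pos.2 (pow_pos ha n)
    have exponent : (n : ℝ) / 2 + -(n : ℝ) * (1 / 2) = 0 := by ring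
    rw [Real.enorm_of_nonneg (Real.rpow_nonneg ha.le _), abs_of_pos han,
      ENNReal.ofReal_rpow_of_pos han, ← ENNReal.ofReal_mul (Real.rpow_nonneg ha.le _),
      ← Real.rpow_natCast, ← Real.rpow_neg ha.le, ← Real.rpow_mul ha.le, ENNReal.toReal_div,
      ENNReal.toReal_one, ENNReal.toReal_ofNat, ← Real.rpow_add ha, exponent, Real.rpow_zero,
      ENNReal.ofReal_one]
  have comp_rot := (measurableEmbedding_rot r⁻¹).eLpNorm_map_measure (μ := volume) (p := 2)
    (g := fun x : E n => f (a • x))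
  rw [(measurePreserving_rot r⁻¹).map_eq, eLpNorm_comp_smul (by norm_num) ha.ne',
    finrank_euclideanSpace_fin] at comp_rot
  have dilRot_eq : dilRot (a, r) f = a ^ ((n : ℝ) / 2) • ((fun x => f (a • x)) ∘ rot r⁻¹) := rfl
  rw [dilRot_eq, eLpNorm_const_smul, ← comp_rot, ← mul_assoc, scale, one_mul]

theorem memLp_dilRot (hq : 0 < q.1) (hf : MemLp f 2) : MemLp (dilRot q f) 2 :=
  ⟨(hf.1.comp_quasiMeasurePreserving (quasiMeasurePreserving_dilRot hq.ne')).const_smul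
    (q.1 ^ ((n : ℝ) / 2)), by
    rw [eLpNorm_dilRot hq]
    exact hf.2⟩

theorem isL2Bounded_dilRot (hq : 0 < q.1) : IsL2Bounded (dilRot q) where
  memLp := memLp_dilRot hq
  sub f g := by
    ext1 x
    exact smul_sub ..
  bound := ⟨1, fun _ => by rw [eLpNorm_dilRot hq, ENNReal.coe_one, one_mul]⟩

theorem integrable_dilRot (hq : 0 < q.1) (hf : Integrable f) : Integrable (dilRot q f) :=
  (((measurePreserving_rot q.2⁻¹).integrable_comp_emb (measurableEmbedding_rot q.2⁻¹)).2
    (hf.comp_smul hq.ne')).smul (q.1 ^ ((n : ℝ) / 2))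

theorem cftIntegral_dilRot_inv {a : ℝ} (ha : 0 < a) (r : SO n) (f : E n → Cl n) :
    cftIntegral (dilRot (a⁻¹, r) f) = dilRot (a, r) (cftIntegral f) := by
  ext1 ω
  have phase (x : E n) : inner ℝ (a • rot r⁻¹ ω) (a⁻¹ • rot r⁻¹ x) = inner ℝ ω x := by
    rw [inner_smul_left, inner_smul_right, inner_rot_rot, conj_trivial, mul_inv_cancel_left₀ ha.ne']
  have change_var := integral_comp_smul_rot a⁻¹ r⁻¹
    fun y => f y * expI (-inner ℝ (a • rot r⁻¹ ω) y)
  have scale : a⁻¹ ^ ((n : ℝ) / 2) * |(a⁻¹ ^ n)⁻¹| = a ^ ((n : ℝ) / 2) := by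
    rw [inv_pow, inv_inv, abs_of_pos (pow_pos ha n), ← rpow_half_mul_self ha.le,
      Real.inv_rpow ha.le, inv_mul_cancel_left₀ (Real.rpow_pos_of_pos ha _).ne']
  simp only [phase] at change_var
  simp only [cftIntegral, dilRot, smul_mul_assoc, integral_smul, change_var]
  rw [smul_smul, scale]

theorem IsCFT.dilRot_inv (hn : n % 4 = 2 ∨ n % 4 = 3) (hf : MemLp f 2) (h : IsCFT f F) {a : ℝ}
    (ha : 0 < a) (r : SO n) : IsCFT (dilRot (a⁻¹, r) f) (dilRot (a, r) F) :=
  h.intertwine hn hf (isL2Bounded_dilRot (inv_pos.2 ha)) (isL2Bounded_dilRot ha)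
    (fun _ => integrable_dilRot (inv_pos.2 ha)) fun φ _ => cftIntegral_dilRot_inv ha r φ

end DilRot

section Translation

variable {n : ℕ} {f F : E n → Cl n}

theorem isL2Bounded_comp_sub_right (b : E n) :
    IsL2Bounded fun (f : E n → Cl n) x => f (x - b) where
  memLp hf := hf.comp_measurePreserving (measurePreserving_sub_right volume b)
  sub _ _ := rfl
  bound := ⟨1, fun hf => by
    rw [ENNReal.coe_one, one_mul]
    exact (eLpNorm_comp_measurePreserving hf.1 (measurePreserving_sub_right volume b)).le⟩

theorem isL2Bounded_mul_expI (hn : n % 4 = 2 ∨ n % 4 = 3) {φ : E n → ℝ} (hφ : Continuous φ) :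
    IsL2Bounded fun (f : E n → Cl n) ω => f ω * expI (φ ω) where
  memLp hf := hf.of_le (hf.1.mul ((continuous_expI hn).comp hφ).aestronglyMeasurable)
    (ae_of_all _ fun _ => (norm_mul_expI hn _ _).le)
  sub f g := by
    ext1 ω
    exact sub_mul ..
  bound := ⟨1, fun _ => by
    rw [ENNReal.coe_one, one_mul]
    exact eLpNorm_mono fun _ => (norm_mul_expI hn _ _).le⟩

theorem cftIntegral_comp_sub_right (hn : n % 4 = 2 ∨ n % 4 = 3) (hf : Integrable f) (b ω : E n) :
    cftIntegral (fun x => f (x - b)) ω = cftIntegral f ω * expI (-inner ℝ ω b) := by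
  calc ∫ x, f (x - b) * expI (-inner ℝ ω x)
      = ∫ x, f x * expI (-inner ℝ ω (x + b)) := by
        simpa using integral_sub_right_eq_self (fun x => f x * expI (-inner ℝ ω (x + b))) b
    _ = ∫ x, (mulL n).flip (expI (-inner ℝ ω b)) (f x * expI (-inner ℝ ω x)) := by
        refine integral_congr_ae (ae_of_all _ fun x => ?_)
        dsimp only
        rw [inner_add_right, neg_add, expI_add hn, ← mul_assoc]
        rfl
    _ = cftIntegral f ω * expI (-inner ℝ ω b) :=
        ContinuousLinearMap.integral_comp_comm _ (integrable_mul_expI hn hf (by fun_prop))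

theorem IsCFT.comp_sub_right (hn : n % 4 = 2 ∨ n % 4 = 3) (hf : MemLp f 2) (h : IsCFT f F)
    (b : E n) : IsCFT (fun x => f (x - b)) fun ω => F ω * expI (-inner ℝ ω b) :=
  h.intertwine hn hf (isL2Bounded_comp_sub_right b) (isL2Bounded_mul_expI hn (by fun_prop))
    (fun _ hφ => hφ.comp_sub_right b) fun _ hφ => funext (cftIntegral_comp_sub_right hn hφ b)

end Translation

section Daughter

variable {n : ℕ} {ψ F : E n → Cl n} {q : ℝ × SO n}

theorem daughter_eq_dilRot (hq : 0 < q.1) (ψ : E n → Cl n) (b : E n) :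
    daughter ψ (q, b) = fun x => dilRot (q.1⁻¹, q.2) ψ (x - b) := by
  ext1 x
  simp only [daughter, dilRot, rot_smul, one_div, Real.inv_rpow hq.le]

theorem memLp_daughter (hψ : MemLp ψ 2) (hq : 0 < q.1) (b : E n) : MemLp (daughter ψ (q, b)) 2 := by
  rw [daughter_eq_dilRot hq]
  exact (isL2Bounded_comp_sub_right b).memLp (memLp_dilRot (q := (q.1⁻¹, q.2)) (inv_pos.2 hq) hψ)

theorem IsCFT.daughter (hn : n % 4 = 2 ∨ n % 4 = 3) (hψ : MemLp ψ 2) (h : IsCFT ψ F) (hq : 0 < q.1)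
    (b : E n) : IsCFT (daughter ψ (q, b)) fun ω => dilRot q F ω * expI (-inner ℝ ω b) := by
  rw [daughter_eq_dilRot hq]
  exact (h.dilRot_inv hn hψ hq q.2).comp_sub_right hn
    (memLp_dilRot (q := (q.1⁻¹, q.2)) (inv_pos.2 hq) hψ) b

end Daughter

/-! ### The measure on `SIM(n)` -/

section SimMeasure

variable {n : ℕ} {ν : Measure (SO n)} {F : E n → Cl n}

theorem ae_dilRotMeasure_pos (ν : Measure (SO n)) : ∀ᵐ q ∂dilRotMeasure n ν, 0 < q.1 :=
  Measure.quasiMeasurePreserving_fst.ae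
    ((withDensity_absolutelyContinuous _ _).ae_le (ae_restrict_mem measurableSet_Ioi))

theorem ae_simMeasure_pos (ν : Measure (SO n)) : ∀ᵐ p ∂simMeasure n ν, 0 < p.1.1 :=
  Measure.quasiMeasurePreserving_fst.ae (ae_dilRotMeasure_pos ν)

instance instSFiniteDilRotMeasure (n : ℕ) (ν : Measure (SO n)) [SFinite ν] :
    SFinite (dilRotMeasure n ν) := by
  rw [dilRotMeasure]
  infer_instance

theorem ae_ae_of_ae_simMeasure [SFinite ν] {P : (ℝ × SO n) × E n → Prop}
    (h : ∀ᵐ z ∂simMeasure n ν, P z) :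
    ∀ᵐ ω : E n, ∀ᵐ q ∂dilRotMeasure n ν, P (q, ω) :=
  Measure.ae_ae_of_ae_prod (Measure.measurePreserving_swap.quasiMeasurePreserving.ae h)

theorem quasiMeasurePreserving_smul_rot_inv (ν : Measure (SO n)) :
    Measure.QuasiMeasurePreserving (fun z : (ℝ × SO n) × E n => z.1.1 • rot z.1.2⁻¹ z.2)
      (simMeasure n ν) volume := by
  have rot_cont : Continuous fun z : (ℝ × SO n) × E n => rot z.1.2⁻¹ z.2 :=
    continuous_rot_inv.comp (f := fun z : (ℝ × SO n) × E n => (z.1.2, z.2)) (by fun_prop)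
  have meas : Measurable fun z : (ℝ × SO n) × E n => z.1.1 • rot z.1.2⁻¹ z.2 :=
    ((continuous_fst.comp continuous_fst).smul rot_cont).measurable
  refine QuasiMeasurePreserving.prod_of_right meas ?_
  filter_upwards [ae_dilRotMeasure_pos ν] with q hq
  exact quasiMeasurePreserving_dilRot hq.ne'

theorem aestronglyMeasurable_dilRot (hF : AEStronglyMeasurable F) :
    AEStronglyMeasurable (fun z => dilRot z.1 F z.2) (simMeasure n ν) := by
  have dilation_meas : Measurable fun z : (ℝ × SO n) × E n => z.1.1 ^ ((n : ℝ) / 2) :=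
    (measurable_fst.comp measurable_fst).pow_const _
  exact dilation_meas.aestronglyMeasurable.smul
    (hF.comp_quasiMeasurePreserving (quasiMeasurePreserving_smul_rot_inv ν))

end SimMeasure

/-! ### Consequences of the grade restriction -/

section GradeRestricted

variable {n : ℕ} {ε : ℤˣ} {ψ F : E n → Cl n}

theorem GradeRestricted.exists_signCommutes (hn : n % 4 = 2 ∨ n % 4 = 3)
    (h : GradeRestricted ψ) : ∃ ε : ℤˣ, ∀ᵐ x, SignCommutes ε (ψ x) := by
  rcases hn with hn₂ | hn₃
  · have n_even : Even n := Nat.even_iff.2 (by omega)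
    rcases h hn₂ with even | odd
    · refine ⟨1, even.mono fun x hx => ?_⟩
      rw [SignCommutes, pseudoscalar_mul_of_even n_even,
        CliffordAlgebra.involute_eq_of_mem_even hx, one_smul]
    · refine ⟨-1, odd.mono fun x hx => ?_⟩
      rw [SignCommutes, pseudoscalar_mul_of_even n_even,
        CliffordAlgebra.involute_eq_of_mem_odd hx, neg_mul, Units.neg_smul, one_smul]
  · refine ⟨1, ae_of_all _ fun x => ?_⟩
    rw [SignCommutes, pseudoscalar_mul_of_odd (Nat.odd_iff.2 (by omega)), one_smul]

theorem IsCFT.ae_eq_zero (hn : n % 4 = 2 ∨ n % 4 = 3) (h : IsCFT ψ F) (hψ : ψ =ᵐ[volume] 0) :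
    F =ᵐ[volume] 0 := by
  have hψ' : MemLp ψ 2 := (memLp_congr_ae hψ).2 MemLp.zero
  rw [← eLpNorm_eq_zero_iff h.memLp.1 two_ne_zero, h.eLpNorm_eq hn hψ',
    (eLpNorm_eq_zero_iff hψ'.1 two_ne_zero).2 hψ, mul_zero]

theorem IsCFT.ae_signCommutes (hn : n % 4 = 2 ∨ n % 4 = 3) (hψ : MemLp ψ 2) (h : IsCFT ψ F)
    (hε : ∀ᵐ x, SignCommutes ε (ψ x)) : ∀ᵐ ω, SignCommutes ε (F ω) := by
  let L : Cl n →L[ℝ] Cl n := mulL n (pseudoscalar n) - ε • (mulL n).flip (pseudoscalar n)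
  have expI_comm (t : ℝ) : expI t * pseudoscalar n = pseudoscalar n * expI t := by
    simp [expI_eq hn, mul_add, add_mul]
  have hL (M : Cl n) (t : ℝ) : L (M * expI t) = L M * expI t := by
    change pseudoscalar n * (M * expI t) - ε • (M * expI t * pseudoscalar n) =
      (pseudoscalar n * M - ε • (M * pseudoscalar n)) * expI t
    rw [sub_mul, smul_mul_assoc, mul_assoc, mul_assoc, mul_assoc, expI_comm]
  have hLψ : (fun x => L (ψ x)) =ᵐ[volume] 0 := hε.mono fun x => sub_eq_zero.2
  exact ((h.clm_comp hn hψ hL).ae_eq_zero hn hLψ).mono fun ω => sub_eq_zero.1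

end GradeRestricted

/-! ### Admissibility -/

section Admissibility

variable {n : ℕ} {ν : Measure (SO n)} {ε : ℤˣ} {F ψ : E n → Cl n} {C : Cl n}

/-- `C` is the admissibility constant of a wavelet with Clifford Fourier transform `F`. The factor
`aⁿ` of the paper is split between the two occurrences of `F`. -/
def HasAdmissibilityConstant (ν : Measure (SO n)) (F : E n → Cl n) (C : Cl n) : Prop :=
  ∀ᵐ ω : E n, Integrable (fun q => rev (dilRot q F ω) * dilRot q F ω) (dilRotMeasure n ν) ∧
    ∫ q, rev (dilRot q F ω) * dilRot q F ω ∂dilRotMeasure n ν = C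

theorem rev_dilRot_mul_dilRot {q : ℝ × SO n} (hq : 0 ≤ q.1) (F : E n → Cl n) (ω : E n) :
    rev (dilRot q F ω) * dilRot q F ω = admissibilityIntegrand F ω q := by
  rw [dilRot, rev_smul, smul_mul_smul_comm, rpow_half_mul_self hq, admissibilityIntegrand]

theorem IsAdmissible.exists_hasAdmissibilityConstant (h : IsAdmissible ν ψ C) :
    ∃ F, IsCFT ψ F ∧ HasAdmissibilityConstant ν F C := by
  obtain ⟨F, hF, hC⟩ := h.constant
  refine ⟨F, hF, hC.mono fun ω hω => ?_⟩
  have integrand_ae_eq : admissibilityIntegrand F ω =ᵐ[dilRotMeasure n ν]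
      fun q => rev (dilRot q F ω) * dilRot q F ω :=
    (ae_dilRotMeasure_pos ν).mono fun q hq => (rev_dilRot_mul_dilRot hq.le F ω).symm
  exact ⟨hω.1.congr integrand_ae_eq, (integral_congr_ae integrand_ae_eq).symm.trans hω.2⟩

theorem HasAdmissibilityConstant.commute (hn : n % 4 = 2 ∨ n % 4 = 3) [SFinite ν]
    (h : HasAdmissibilityConstant ν F C) (hF : ∀ᵐ ω, SignCommutes ε (F ω)) :
    Commute (pseudoscalar n) C := by
  have sign_ae := ae_ae_of_ae_simMeasure ((quasiMeasurePreserving_smul_rot_inv ν).ae hF)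
  obtain ⟨ω, ⟨integrable, rfl⟩, hω⟩ := (h.and sign_ae).exists
  have left := (mulL n (pseudoscalar n)).integral_comp_comm integrable
  have right := ((mulL n).flip (pseudoscalar n)).integral_comp_comm integrable
  refine (left.symm.trans (integral_congr_ae ?_)).trans right
  filter_upwards [hω] with q hq
  exact (hq.smul _).commute_rev_mul hn

theorem HasAdmissibilityConstant.integral_norm_sq (h : HasAdmissibilityConstant ν F C) :
    ∀ᵐ ω, Integrable (fun q => ‖dilRot q F ω‖ ^ 2) (dilRotMeasure n ν) ∧
      ∫ q, ‖dilRot q F ω‖ ^ 2 ∂dilRotMeasure n ν = coord ∅ C := by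
  have coord_eq (M : Cl n) : coord ∅ (rev M * M) = ‖M‖ ^ 2 := by
    rw [← norm_rev, ← real_inner_self_eq_norm_sq, ← coord_empty_mul_rev, rev_rev]
  filter_upwards [h] with ω hω
  have integrable := (coord ∅).integrable_comp hω.1
  have integral := (coord ∅).integral_comp_comm hω.1
  simp only [coord_eq, hω.2] at integrable integral
  exact ⟨integrable, integral⟩

end Admissibility

/-! ### Partial Clifford Fourier transforms -/

section PartialCFT

variable {X : Type*} [MeasurableSpace X] {μ : Measure X}

theorem ae_memLp_prodMk_left {Y V : Type*} [MeasurableSpace Y] {ρ : Measure Y} [SFinite μ]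
    [SFinite ρ] [NormedAddCommGroup V] {H : X × Y → V} (hH : MemLp H 2 (μ.prod ρ)) :
    ∀ᵐ x ∂μ, MemLp (fun y => H (x, y)) 2 ρ := by
  filter_upwards [hH.1.prodMk_left, (hH.integrable_norm_pow two_ne_zero).prod_right_ae]
    with x meas integrable
  exact (memLp_two_iff_integrable_sq_norm meas).2 integrable

theorem eLpNorm_two_sq {V : Type*} [NormedAddCommGroup V] (f : X → V) :
    eLpNorm f 2 μ ^ 2 = ∫⁻ x, ‖f x‖ₑ ^ 2 ∂μ := by
  simpa using eLpNorm_nnreal_pow_eq_lintegral (f := f) (μ := μ) (p := 2) two_ne_zero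

theorem eLpNorm_two_prod_sq {Y V : Type*} [MeasurableSpace Y] {ρ : Measure Y} [SFinite ρ]
    [NormedAddCommGroup V] {H : X × Y → V} (hH : AEStronglyMeasurable H (μ.prod ρ)) :
    eLpNorm H 2 (μ.prod ρ) ^ 2 = ∫⁻ x, eLpNorm (fun y => H (x, y)) 2 ρ ^ 2 ∂μ := by
  rw [eLpNorm_two_sq, lintegral_prod _ (hH.enorm.pow_const 2)]
  simp only [eLpNorm_two_sq]

variable {n : ℕ} {H K : X × E n → Cl n}

/-- The Clifford Fourier integral in the second variable. -/
def partialCFT (H : X × E n → Cl n) (z : X × E n) : Cl n := cftIntegral (fun ω => H (z.1, ω)) z.2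

theorem aestronglyMeasurable_partialCFT [SFinite μ] (hn : n % 4 = 2 ∨ n % 4 = 3)
    (hH : AEStronglyMeasurable H (μ.prod volume)) :
    AEStronglyMeasurable (partialCFT H) (μ.prod volume) := by
  have kernel : StronglyMeasurable fun w : (X × E n) × E n => (expI (-inner ℝ w.1.2 w.2) : Cl n) :=
    ((continuous_expI hn).stronglyMeasurable).comp_measurable (by fun_prop)
  have H_meas : AEStronglyMeasurable (fun w : (X × E n) × E n => H (w.1.1, w.2))
      ((μ.prod volume).prod volume) :=
    hH.comp_quasiMeasurePreserving
      (QuasiMeasurePreserving.prodMap Measure.quasiMeasurePreserving_fst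
        (Measure.QuasiMeasurePreserving.id volume))
  exact (H_meas.mul kernel.aestronglyMeasurable).integral_prod_right'

variable [SFinite μ]

theorem eLpNorm_partialCFT (hn : n % 4 = 2 ∨ n % 4 = 3) (h₁ : ∀ᵐ x ∂μ, Integrable fun ω => H (x, ω))
    (h₂ : MemLp H 2 (μ.prod volume)) :
    eLpNorm (partialCFT H) 2 (μ.prod volume) =
      plancherelConst n * eLpNorm H 2 (μ.prod volume) := by
  refine (ENNReal.pow_right_strictMono two_ne_zero).injective ?_
  rw [mul_pow, eLpNorm_two_prod_sq (aestronglyMeasurable_partialCFT hn h₂.1),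
    eLpNorm_two_prod_sq h₂.1, ← lintegral_const_mul' _ _ (by finiteness)]
  refine lintegral_congr_ae ?_
  filter_upwards [h₁, ae_memLp_prodMk_left h₂] with x i₁ i₂
  rw [← mul_pow, ← eLpNorm_cftIntegral hn i₁ i₂]
  rfl

theorem memLp_partialCFT (hn : n % 4 = 2 ∨ n % 4 = 3) (h₁ : ∀ᵐ x ∂μ, Integrable fun ω => H (x, ω))
    (h₂ : MemLp H 2 (μ.prod volume)) : MemLp (partialCFT H) 2 (μ.prod volume) :=
  ⟨aestronglyMeasurable_partialCFT hn h₂.1, by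
    rw [eLpNorm_partialCFT hn h₁ h₂]
    exact ENNReal.mul_lt_top ENNReal.coe_lt_top h₂.2⟩

theorem integral_partialCFT_mul_rev (hn : n % 4 = 2 ∨ n % 4 = 3)
    (hH₁ : ∀ᵐ x ∂μ, Integrable fun ω => H (x, ω)) (hH₂ : MemLp H 2 (μ.prod volume))
    (hK₁ : ∀ᵐ x ∂μ, Integrable fun ω => K (x, ω)) (hK₂ : MemLp K 2 (μ.prod volume)) :
    ∫ z, partialCFT H z * rev (partialCFT K z) ∂μ.prod volume =
      (2 * Real.pi) ^ n • ∫ z, H z * rev (K z) ∂μ.prod volume := by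
  rw [integral_prod _ (integrable_mul_rev (memLp_partialCFT hn hH₁ hH₂)
    (memLp_partialCFT hn hK₁ hK₂)), integral_prod _ (integrable_mul_rev hH₂ hK₂), ← integral_smul]
  refine integral_congr_ae ?_
  filter_upwards [hH₁, ae_memLp_prodMk_left hH₂, hK₁, ae_memLp_prodMk_left hK₂] with x i₁ i₂ j₁ j₂
  exact (isCFT_cftIntegral hn i₁ i₂).integral_mul_rev hn i₂ j₂ (isCFT_cftIntegral hn j₁ j₂)

end PartialCFT

/-! ### The wavelet transform in the frequency domain -/

section FreqTransform

variable {n : ℕ} {ν : Measure (SO n)} {ε : ℤˣ} {ψ f h F G H : E n → Cl n} {C : Cl n}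
  {q : ℝ × SO n}

/-- The function `ω ↦ G(ω) (a^{n/2} F(a r_θ⁻¹ ω))~` whose Clifford Fourier transform is the wavelet
transform, when `F` and `G` are the Clifford Fourier transforms of the wavelet and of the signal. -/
def freqTransform (F G : E n → Cl n) (z : (ℝ × SO n) × E n) : Cl n :=
  G z.2 * rev (dilRot z.1 F z.2)

theorem integrable_freqTransform (hF : MemLp F 2) (hG : MemLp G 2) (ν : Measure (SO n)) :
    ∀ᵐ q ∂dilRotMeasure n ν, Integrable fun ω => freqTransform F G (q, ω) := by
  filter_upwards [ae_dilRotMeasure_pos ν] with q hq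
  exact integrable_mul_rev hG (memLp_dilRot hq hF)

theorem waveletTransform_eq_partialCFT (hn : n % 4 = 2 ∨ n % 4 = 3) (hψ : MemLp ψ 2)
    (hf : MemLp f 2) (hF : IsCFT ψ F) (hG : IsCFT f G) (hε : ∀ᵐ ω, SignCommutes ε (F ω))
    (hq : 0 < q.1) (b : E n) :
    waveletTransform ψ f (q, b) =
      ((2 * Real.pi) ^ n)⁻¹ • partialCFT (freqTransform F G) (q, -(ε • b)) := by
  have parseval := hG.integral_mul_rev hn hf (memLp_daughter hψ hq b) (hF.daughter hn hψ hq b)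
  rw [eq_inv_smul_iff₀ (by positivity)]
  refine parseval.symm.trans (integral_congr_ae ?_)
  filter_upwards [(quasiMeasurePreserving_dilRot hq.ne').ae hε] with ω hω
  have phase : ε • inner ℝ ω b = -inner ℝ (-(ε • b)) ω := by
    rcases Int.units_eq_one_or ε with rfl | rfl <;> simp [real_inner_comm]
  have dilRot_sign : SignCommutes ε (dilRot q F ω) := hω.smul _
  rw [rev_mul, rev_expI hn, neg_neg, (dilRot_sign.rev hn).expI_mul hn, ← mul_assoc, phase]
  rfl

theorem waveletTransform_ae_eq (hn : n % 4 = 2 ∨ n % 4 = 3) (hψ : MemLp ψ 2) (hf : MemLp f 2)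
    (hF : IsCFT ψ F) (hG : IsCFT f G) (hε : ∀ᵐ ω, SignCommutes ε (F ω)) :
    waveletTransform ψ f =ᵐ[simMeasure n ν]
      fun p => ((2 * Real.pi) ^ n)⁻¹ • partialCFT (freqTransform F G) (p.1, -(ε • p.2)) :=
  (ae_simMeasure_pos ν).mono fun p hp =>
    waveletTransform_eq_partialCFT hn hψ hf hF hG hε hp p.2

variable [SFinite ν]

theorem memLp_norm_mul_norm_dilRot (hF : AEStronglyMeasurable F) (hG : MemLp G 2)
    (hC : HasAdmissibilityConstant ν F C) :
    MemLp (fun z => ‖G z.2‖ * ‖dilRot z.1 F z.2‖) 2 (simMeasure n ν) := by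
  have meas : AEStronglyMeasurable (fun z => ‖G z.2‖ * ‖dilRot z.1 F z.2‖) (simMeasure n ν) :=
    hG.1.comp_snd.norm.mul (aestronglyMeasurable_dilRot hF).norm
  refine (memLp_two_iff_integrable_sq meas).2 ((integrable_prod_iff' (meas.pow 2)).2 ⟨?_, ?_⟩)
  · filter_upwards [hC.integral_norm_sq] with ω hω
    simpa only [Pi.pow_apply, mul_pow] using hω.1.const_mul (‖G ω‖ ^ 2)
  · refine ((hG.integrable_norm_pow two_ne_zero).mul_const (coord ∅ C)).congr ?_
    filter_upwards [hC.integral_norm_sq] with ω hω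
    simp only [Pi.pow_apply, mul_pow, norm_mul, norm_pow, norm_norm, integral_const_mul, hω.2]

theorem memLp_freqTransform (hF : AEStronglyMeasurable F) (hG : MemLp G 2)
    (hC : HasAdmissibilityConstant ν F C) : MemLp (freqTransform F G) 2 (simMeasure n ν) := by
  refine (memLp_norm_mul_norm_dilRot hF hG hC).of_le_mul (c := ‖mulL n‖)
    (hG.1.comp_snd.mul ((revL n).continuous.comp_aestronglyMeasurable
      (aestronglyMeasurable_dilRot hF))) (ae_of_all _ fun z => ?_)
  simpa [freqTransform, mul_assoc] using norm_mul_le_opNorm (G z.2) (rev (dilRot z.1 F z.2))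

theorem integral_freqTransform_mul_rev (hF : AEStronglyMeasurable F) (hG : MemLp G 2)
    (hH : MemLp H 2) (hC : HasAdmissibilityConstant ν F C) :
    ∫ z, freqTransform F G z * rev (freqTransform F H z) ∂simMeasure n ν =
      ∫ ω, G ω * C * rev (H ω) := by
  rw [simMeasure, integral_prod_symm _
    (integrable_mul_rev (memLp_freqTransform hF hG hC) (memLp_freqTransform hF hH hC))]
  refine integral_congr_ae ?_
  filter_upwards [hC] with ω hω
  let L : Cl n →L[ℝ] Cl n := (mulL n).flip (rev (H ω)) ∘L mulL n (G ω)
  rw [← hω.2]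
  refine Eq.trans ?_ (L.integral_comp_comm hω.1)
  refine integral_congr_ae (ae_of_all _ fun q => ?_)
  change G ω * rev (dilRot q F ω) * rev (H ω * rev (dilRot q F ω)) =
    G ω * (rev (dilRot q F ω) * dilRot q F ω) * rev (H ω)
  simp only [rev_mul, rev_rev, mul_assoc]

theorem measurePreserving_prodMk_neg_smul {X : Type*} [MeasurableSpace X] (μ : Measure X)
    [SFinite μ] (ε : ℤˣ) : MeasurePreserving (fun p : X × E n => (p.1, -(ε • p.2))) (μ.prod volume)
      (μ.prod volume) := by
  suffices h : MeasurePreserving fun b : E n => -(ε • b) from (MeasurePreserving.id μ).prod h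
  rcases Int.units_eq_one_or ε with rfl | rfl
  · simpa using Measure.measurePreserving_neg (volume : Measure (E n))
  · simp only [Units.neg_smul, one_smul, neg_neg]
    exact MeasurePreserving.id _

theorem memLp_waveletTransform (hn : n % 4 = 2 ∨ n % 4 = 3) (hψ : MemLp ψ 2) (hf : MemLp f 2)
    (hF : IsCFT ψ F) (hε : ∀ᵐ ω, SignCommutes ε (F ω)) (hC : HasAdmissibilityConstant ν F C) :
    MemLp (waveletTransform ψ f) 2 (simMeasure n ν) := by
  obtain ⟨G, hG⟩ := exists_isCFT hn hf
  have memLp_cft := memLp_partialCFT hn (integrable_freqTransform hF.memLp hG.memLp ν)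
    (memLp_freqTransform hF.memLp.1 hG.memLp hC)
  exact (memLp_congr_ae (waveletTransform_ae_eq hn hψ hf hF hG hε)).2
    ((memLp_cft.comp_measurePreserving (measurePreserving_prodMk_neg_smul _ ε)).const_smul
      ((2 * Real.pi) ^ n)⁻¹)

theorem integral_waveletTransform_mul_rev (hn : n % 4 = 2 ∨ n % 4 = 3) (hψ : MemLp ψ 2)
    (hf : MemLp f 2) (hh : MemLp h 2) (hF : IsCFT ψ F) (hG : IsCFT f G) (hH : IsCFT h H)
    (hε : ∀ᵐ ω, SignCommutes ε (F ω)) (hC : HasAdmissibilityConstant ν F C) :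
    ∫ p, waveletTransform ψ f p * rev (waveletTransform ψ h p) ∂simMeasure n ν =
      ((2 * Real.pi) ^ n)⁻¹ • ∫ ω, G ω * C * rev (H ω) := by
  set c := (2 * Real.pi) ^ n
  have hc : c ≠ 0 := by positivity
  have iG := integrable_freqTransform hF.memLp hG.memLp ν
  have iH := integrable_freqTransform hF.memLp hH.memLp ν
  have mG := memLp_freqTransform hF.memLp.1 hG.memLp hC
  have mH := memLp_freqTransform hF.memLp.1 hH.memLp hC
  let Φ (p : (ℝ × SO n) × E n) : Cl n :=
    partialCFT (freqTransform F G) p * rev (partialCFT (freqTransform F H) p)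
  have reflect := measurePreserving_prodMk_neg_smul (n := n) (dilRotMeasure n ν) ε
  have Φ_meas : AEStronglyMeasurable Φ (simMeasure n ν) :=
    (integrable_mul_rev (memLp_partialCFT hn iG mG) (memLp_partialCFT hn iH mH)).1
  have integral_reflect :
      ∫ p, Φ (p.1, -(ε • p.2)) ∂simMeasure n ν = ∫ p, Φ p ∂simMeasure n ν := by
    have h_map := integral_map (f := Φ) reflect.aemeasurable (by rwa [reflect.map_eq])
    rw [reflect.map_eq] at h_map
    exact h_map.symm
  calc ∫ p, waveletTransform ψ f p * rev (waveletTransform ψ h p) ∂simMeasure n ν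
      = ∫ p, (c⁻¹ * c⁻¹) • Φ (p.1, -(ε • p.2)) ∂simMeasure n ν := by
        refine integral_congr_ae ?_
        filter_upwards [waveletTransform_ae_eq hn hψ hf hF hG hε,
          waveletTransform_ae_eq hn hψ hh hF hH hε] with p hpf hph
        rw [hpf, hph, rev_smul, smul_mul_smul_comm]
    _ = (c⁻¹ * c⁻¹) • ∫ p, Φ p ∂simMeasure n ν := by
        rw [integral_smul, integral_reflect]
    _ = c⁻¹ • ∫ ω, G ω * C * rev (H ω) := by
        rw [← integral_freqTransform_mul_rev hF.memLp.1 hG.memLp hH.memLp hC, mul_smul]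
        congr 1
        rw [inv_smul_eq_iff₀ hc]
        exact integral_partialCFT_mul_rev hn iG mG iH mH

end FreqTransform

/-! ### Inversion -/

section Inversion

variable {n : ℕ} {ν : Measure (SO n)} {ψ f g : E n → Cl n} {C : Cl n}

theorem memLp_mul_const (hg : MemLp g 2) (D : Cl n) : MemLp (fun x => g x * D) 2 :=
  ((mulL n).flip D).comp_memLp' hg

theorem cliffInner_mul_mul {φ : E n → Cl n} (hφ : MemLp φ 2) (hg : MemLp g 2) (M D : Cl n) :
    cliffInner (fun x => M * φ x * rev D) g = M * rev (cliffInner (fun x => g x * D) φ) := by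
  let L : Cl n →L[ℝ] Cl n := mulL n M ∘L revL n
  refine Eq.trans ?_ (L.integral_comp_comm (integrable_mul_rev (memLp_mul_const hg D) hφ))
  refine integral_congr_ae (ae_of_all _ fun x => ?_)
  change M * φ x * rev D * rev (g x) = M * rev (g x * D * rev (φ x))
  simp only [rev_mul, rev_rev, mul_assoc]

theorem memLp_mul_mul {φ : E n → Cl n} (hφ : MemLp φ 2) (M N : Cl n) :
    MemLp (fun x => M * φ x * N) 2 :=
  ((mulL n).flip N ∘L mulL n M).comp_memLp' hφ

theorem signCommutes_rev_inverse (hn : n % 4 = 2 ∨ n % 4 = 3) (hC : IsUnit C)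
    (h : Commute (pseudoscalar n) C) : SignCommutes 1 (rev (Ring.inverse C)) := by
  obtain ⟨u, rfl⟩ := hC
  refine SignCommutes.rev hn ?_
  rw [SignCommutes, one_smul, Ring.inverse_unit]
  exact h.units_inv_right

theorem IsCFT.mul_const (hn : n % 4 = 2 ∨ n % 4 = 3) {g K : E n → Cl n} {D : Cl n}
    (hg : MemLp g 2) (h : IsCFT g K) (hD : SignCommutes 1 D) :
    IsCFT (fun x => g x * D) fun ω => K ω * D := by
  refine h.clm_comp (L := (mulL n).flip D) hn hg fun M t => ?_
  change M * expI t * D = M * D * expI t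
  rw [mul_assoc, hD.expI_mul hn, one_smul, mul_assoc]

variable [SFinite ν]

theorem IsAdmissible.memLp_waveletTransform (hψ : IsAdmissible ν ψ C)
    (hn : n % 4 = 2 ∨ n % 4 = 3) (hgrade : GradeRestricted ψ) (hf : MemLp f 2) :
    MemLp (waveletTransform ψ f) 2 (simMeasure n ν) := by
  obtain ⟨F, hF, hC⟩ := hψ.exists_hasAdmissibilityConstant
  obtain ⟨ε, hε⟩ := hgrade.exists_signCommutes hn
  exact CliffordWavelet.memLp_waveletTransform hn hψ.memLp hf hF
    (hF.ae_signCommutes hn hψ.memLp hε) hC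

theorem IsAdmissible.integral_waveletTransform_mul_rev (hψ : IsAdmissible ν ψ C)
    (hn : n % 4 = 2 ∨ n % 4 = 3) (hgrade : GradeRestricted ψ) (hf : MemLp f 2) (hg : MemLp g 2) :
    ∫ p, waveletTransform ψ f p * rev (waveletTransform ψ (fun x => g x * rev (Ring.inverse C)) p)
      ∂simMeasure n ν = cliffInner f g := by
  obtain ⟨F, hF, hC⟩ := hψ.exists_hasAdmissibilityConstant
  obtain ⟨ε, hε⟩ := hgrade.exists_signCommutes hn
  have F_sign := hF.ae_signCommutes hn hψ.memLp hε
  obtain ⟨G, hG⟩ := exists_isCFT hn hf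
  obtain ⟨K, hK⟩ := exists_isCFT hn hg
  have hKD := hK.mul_const hn hg (signCommutes_rev_inverse hn hψ.isUnit (hC.commute hn F_sign))
  have cancel (ω : E n) : G ω * C * rev (K ω * rev (Ring.inverse C)) = G ω * rev (K ω) := by
    rw [rev_mul, rev_rev, mul_assoc, Ring.mul_inverse_cancel_left _ _ hψ.isUnit]
  rw [CliffordWavelet.integral_waveletTransform_mul_rev hn hψ.memLp hf (memLp_mul_const hg _)
    hF hG hKD F_sign hC]
  simp only [cancel]
  rw [hG.integral_mul_rev hn hf hg hK, inv_smul_smul₀ (by positivity), cliffInner]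

end Inversion

end CliffordWavelet

end

theorem mainTheorem2_general (n : ℕ) (hn : n % 4 = 2 ∨ n % 4 = 3) (ν : Measure (SO n)) [SFinite ν]
    (ψ : E n → Cl n) (C : Cl n) (hψ : IsAdmissible ν ψ C) (hgrade : GradeRestricted ψ)
    (f : E n → Cl n) (hf : MemLp f 2 volume) :
    IsWeakIntegral (simMeasure n ν)
      (fun p x => waveletTransform ψ f p * daughter ψ p x * Ring.inverse C) f := by
  refine ⟨(ae_simMeasure_pos ν).mono fun p hp => memLp_mul_mul (memLp_daughter hψ.memLp hp p.2) _ _,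
    fun g hg => ?_⟩
  have transforms : (fun p => cliffInner
      (fun x => waveletTransform ψ f p * daughter ψ p x * Ring.inverse C) g) =ᵐ[simMeasure n ν]
      fun p => waveletTransform ψ f p *
        rev (waveletTransform ψ (fun x => g x * rev (Ring.inverse C)) p) := by
    filter_upwards [ae_simMeasure_pos ν] with p hp
    have pull_out := cliffInner_mul_mul (memLp_daughter hψ.memLp hp p.2) hg (waveletTransform ψ f p)
      (rev (Ring.inverse C))
    rwa [rev_rev] at pull_out
  refine ⟨Integrable.congr ?_ transforms.symm, ?_⟩
  · exact integrable_mul_rev (hψ.memLp_waveletTransform hn hgrade hf)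
      (hψ.memLp_waveletTransform hn hgrade (memLp_mul_const hg _))
  · rw [integral_congr_ae transforms, hψ.integral_waveletTransform_mul_rev hn hgrade hf hg]

theorem mainTheorem2 (n : ℕ) (hn : n % 4 = 2 ∨ n % 4 = 3)
    (ν : Measure (SO n)) [ν.IsHaarMeasure]
    (ψ : E n → Cl n) (C : Cl n) (hψ : IsAdmissible ν ψ C) (hgrade : GradeRestricted ψ)
    (f : E n → Cl n) (hf : MemLp f 2 volume) :
    IsWeakIntegral (simMeasure n ν)
      (fun p x => waveletTransform ψ f p * daughter ψ p x * Ring.inverse C) f ∧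
    IsWeakIntegral (simMeasure n ν)
      (fun p x => cliffInner f (daughter ψ p) * daughter ψ p x * Ring.inverse C) f := by
  have h := mainTheorem2_general n hn ν ψ C hψ hgrade f hf
  exact ⟨h, h⟩
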